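/- A mixed graph $G=(V,D,B)$ consists of a finite node set $V$, a set $D$ of directed edges $v\to w$ and a set $B$ of (unoriented) bidirected edges $v\leftrightarrow w$, both without self-loops; directed cycles are allowed. Let $\Theta$ be the set of pairs $(\Lambda,\Omega)$ of real $V\times V$ matrices such that $\lambda_{vw}=0$ whenever $v\to w\notin D$, $I-\Lambda$ is invertible, $\Omega$ is symmetric positive definite, and $\omega_{vw}=0$ whenever $v\ne w$ and $v\leftrightarrow w\notin B$. Let $\phi_G(\Lambda,\Omega)=(I-\Lambda)^{-T}\Omega(I-\Lambda)^{-1}$ on $\Theta$. A proper algebraic subset of $\Theta$ is a proper subset of $\Theta$ that is defined in $\Theta$ by polynomial equations in the entries of $\Lambda$ and $\Omega$. The graph $G$ is rationally identifiable if there are a proper algebraic subset $A\subset\Theta$ and a rational map $\psi$ such that, for all $(\Lambda,\Omega)\in\Theta\setminus A$, $\psi$ is defined at $\phi_G(\Lambda,\Omega)$ and $\psi(\phi_G(\Lambda,\Omega))=(\Lambda,\Omega)$. It is generically infinite-to-one if there is a proper algebraic subset $A\subset\Theta$ such that the fiber $\{\theta'\in\Theta:\phi_G(\theta')=\phi_G(\theta)\}$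 is infinite for all $\theta\in\Theta\setminus A$. A trek $\pi$ from $v$ to $w$ consists of two directed paths (not necessarily simple, possibly without edges), one ending in $v$ and one ending in $w$, whose starting nodes either coincide or are joined by a bidirected edge; the node sets of the two paths are $\mathrm{Left}(\pi)$ and $\mathrm{Right}(\pi)$, respectively. A half-trek is a trek with $|\mathrm{Left}(\pi)|=1$. A system of treks from $X$ to $Y$ is a set of treks with distinct sources forming the set $X$ and distinct targets forming the set $Y$; it has no sided intersection if any two different treks of it have disjoint left sides and disjoint right sides. Let $\mathrm{pa}(v)=\{w: w\to v\in D\}$, $\mathrm{sib}(v)=\{w: w\leftrightarrow v\in B\}$, and let $\mathrm{htr}(v)$ be the set of nodes in $V\setminus(\{v\}\cup\mathrm{sib}(v))$ that can be reached from $v$ by a half-trek. A set $Y\subseteq V$ satisfies the half-trek criterion with respect to $v$ if (i) $|Y|=|\mathrm{pa}(v)|$, (ii) $Y\cap(\{v\}\cup\mathrm{sib}(v))=\varnothing$, and (iii) there is a system of half-treks with no sided intersection from $Y$ to $\mathrm{pa}(v)$. It satisfies the weak half-trek criterion with respect to $v$ if (i) and (ii) hold and (iii') there is a system of treks with no sided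 intersection from $Y$ to $\mathrm{pa}(v)$ in which, for every $w\in Y\cap\mathrm{htr}(v)$, the trek with source $w$ is a half-trek. Call $G$ HTC-identifiable if there is a family $(Y_v)_{v\in V}$ of subsets of $V$ such that each $Y_v$ satisfies the half-trek criterion with respect to $v$, and a total ordering $\prec$ on $V$ with $w\prec v$ whenever $w\in Y_v\cap\mathrm{htr}(v)$. Call $G$ HTC-infinite-to-one if every family $(Y_v)_{v\in V}$ of subsets of $V$ contains a set $Y_v$ that fails the half-trek criterion with respect to $v$, or contains a pair of sets $Y_v,Y_w$ ($v\ne w$) with $v\in Y_w$ and $w\in Y_v$. Call $G$ weakly HTC-identifiable, respectively weakly HTC-infinite-to-one, if the same conditions hold with the weak half-trek criterion in place of the half-trek criterion. Theorem (Weak HTC). Let $G$ be a mixed graph. If $G$ is weakly HTC-identifiable, then $G$ is rationally identifiable. If $G$ is weakly HTC-infinite-to-one, then $\phi_G$ is generically infinite-to-one. Moreover, $G$ is weakly HTC-identifiable if and only if it is HTC-identifiable, and $G$ is weakly HTC-infinite-to-one if and only if it is HTC-infinite-to-one. -/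

import Mathlib

/-- A mixed graph on the node set `V`: directed edges `D v w` (`v → w`) and bidirected edges
`B v w` (`v ↔ w`), without self-loops; bidirected edges have no orientation. -/
structure MixedGraph (V : Type*) where
  D : V → V → Prop
  B : V → V → Prop
  D_irrefl : ∀ v, ¬ D v v
  B_irrefl : ∀ v, ¬ B v v
  B_symm : ∀ v w, B v w → B w v

/-- A rational map from affine space with coordinates `σ` to affine space with coordinates `τ`:
every coordinate is a quotient of two polynomials. -/
structure RationalMap (σ τ : Type*) where
  num : τ → MvPolynomial σ ℝ
  den : τ → MvPolynomial σ ℝ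
  den_ne_zero : ∀ i, den i ≠ 0

namespace RationalMap

variable {σ τ : Type*}

def IsDefinedAt (ψ : RationalMap σ τ) (x : σ → ℝ) : Prop :=
  ∀ i, MvPolynomial.eval x (ψ.den i) ≠ 0

/-- The value of a rational map (meaningful where the map is defined). -/
noncomputable def eval (ψ : RationalMap σ τ) (x : σ → ℝ) : τ → ℝ :=
  fun i => MvPolynomial.eval x (ψ.num i) / MvPolynomial.eval x (ψ.den i)

end RationalMap

namespace MixedGraph

section Treks

variable {V : Type*} (G : MixedGraph V)

/-- Directed paths (not necessarily simple, possibly without edges). -/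
inductive DiPath : V → V → Type _
  | nil (v : V) : DiPath v v
  | cons {u v w : V} (h : G.D u v) (p : DiPath v w) : DiPath u w

/-- The set of nodes on a directed path. -/
def DiPath.nodes {G : MixedGraph V} : {v w : V} → G.DiPath v w → Set V
  | _, _, .nil v => {v}
  | _, _, .cons (u := u) _ p => insert u p.nodes

/-- A trek from source `v` to target `w`: two directed paths, ending in `v` and in `w`, whose
starting nodes either coincide (the top node) or are joined by a bidirected edge. -/
structure Trek (v w : V) where
  topL : V
  topR : V
  leftPath : G.DiPath topL v
  rightPath : G.DiPath topR w
  link : topL = topR ∨ G.B topL topR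

variable {G} in
/-- `Left(π)`. -/
def Trek.left {v w : V} (π : G.Trek v w) : Set V := π.leftPath.nodes

variable {G} in
/-- `Right(π)`. -/
def Trek.right {v w : V} (π : G.Trek v w) : Set V := π.rightPath.nodes

variable {G} in
/-- A half-trek is a trek with `|Left(π)| = 1`. -/
def Trek.IsHalfTrek {v w : V} (π : G.Trek v w) : Prop := π.left.ncard = 1

/-- A system of treks from `X` to `Y`. As sources are distinct, the treks are indexed by their
sources; as targets are distinct, the source-target assignment is a bijection. -/
structure TrekSystem (X Y : Set V) where
  target : X ≃ Y
  trek : ∀ x : X, G.Trek (x : V) (target x : V)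

variable {G} in
def TrekSystem.NoSidedIntersection {X Y : Set V} (S : G.TrekSystem X Y) : Prop :=
  ∀ i j : X, i ≠ j →
    (S.trek i).left ∩ (S.trek j).left = ∅ ∧ (S.trek i).right ∩ (S.trek j).right = ∅

/-- Parents. -/
def pa (v : V) : Set V := {w | G.D w v}

/-- Siblings. -/
def sib (v : V) : Set V := {w | G.B w v}

/-- Nodes other than `v` and its siblings that can be reached from `v` by a half-trek. -/
def htr (v : V) : Set V :=
  {w | w ∉ ({v} ∪ G.sib v : Set V) ∧ ∃ π : G.Trek v w, π.IsHalfTrek}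

/-- `Y` satisfies the half-trek criterion with respect to `v`. -/
def HalfTrekCriterion (Y : Set V) (v : V) : Prop :=
  Y.ncard = (G.pa v).ncard ∧
  Y ∩ ({v} ∪ G.sib v) = ∅ ∧
  ∃ S : G.TrekSystem Y (G.pa v), S.NoSidedIntersection ∧ ∀ y : Y, (S.trek y).IsHalfTrek

/-- `Y` satisfies the weak half-trek criterion with respect to `v`. -/
def WeakHalfTrekCriterion (Y : Set V) (v : V) : Prop :=
  Y.ncard = (G.pa v).ncard ∧
  Y ∩ ({v} ∪ G.sib v) = ∅ ∧
  ∃ S : G.TrekSystem Y (G.pa v), S.NoSidedIntersection ∧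
    ∀ y : Y, (y : V) ∈ G.htr v → (S.trek y).IsHalfTrek

/-- The graphical condition for identifiability, for a criterion `C` on pairs of a node set and
a node. -/
def IdentifiabilityCondition (C : Set V → V → Prop) : Prop :=
  ∃ Y : V → Set V, (∀ v, C (Y v) v) ∧
    ∃ r : V → V → Prop, IsStrictTotalOrder V r ∧
      ∀ v w, w ∈ Y v ∩ G.htr v → r w v

/-- The graphical condition for nonidentifiability, for a criterion `C` on pairs of a node set
and a node (in a pair `(Y v, Y w)` the nodes `v`, `w` are distinct). -/
def InfiniteToOneCondition (C : Set V → V → Prop) : Prop :=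
  ∀ Y : V → Set V, (∃ v, ¬ C (Y v) v) ∨ ∃ v w, v ≠ w ∧ v ∈ Y w ∧ w ∈ Y v

def HTCIdentifiable : Prop := G.IdentifiabilityCondition G.HalfTrekCriterion

def HTCInfiniteToOne : Prop := InfiniteToOneCondition G.HalfTrekCriterion

def WeakHTCIdentifiable : Prop := G.IdentifiabilityCondition G.WeakHalfTrekCriterion

def WeakHTCInfiniteToOne : Prop := InfiniteToOneCondition G.WeakHalfTrekCriterion

end Treks

section Model

variable {V : Type*} [Fintype V] [DecidableEq V] (G : MixedGraph V)

/-- Matrices with support `D` for which `I - Λ` is invertible. -/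
def regD : Set (Matrix V V ℝ) :=
  {Λ | (∀ v w, ¬ G.D v w → Λ v w = 0) ∧ IsUnit (1 - Λ)}

/-- Positive definite symmetric matrices with support `B`. -/
def PDB : Set (Matrix V V ℝ) :=
  {Ω | Ω.PosDef ∧ ∀ v w, v ≠ w → ¬ G.B v w → Ω v w = 0}

/-- The parameter space. -/
def Theta : Set (Matrix V V ℝ × Matrix V V ℝ) := G.regD ×ˢ G.PDB

/-- The parametrization `(Λ, Ω) ↦ (I - Λ)⁻ᵀ Ω (I - Λ)⁻¹`. -/
noncomputable def phi (θ : Matrix V V ℝ × Matrix V V ℝ) : Matrix V V ℝ :=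
  ((1 - θ.1)⁻¹).transpose * θ.2 * (1 - θ.1)⁻¹

/-- The fiber of the parametrization through `θ`. -/
def fiber (θ : Matrix V V ℝ × Matrix V V ℝ) : Set (Matrix V V ℝ × Matrix V V ℝ) :=
  {θ' | θ' ∈ G.Theta ∧ phi θ' = phi θ}

/-- The entries of a matrix. -/
def entries (M : Matrix V V ℝ) : V × V → ℝ := fun e => M e.1 e.2

/-- The entries of a pair of matrices. -/
def pairEntries (θ : Matrix V V ℝ × Matrix V V ℝ) : (V × V) ⊕ (V × V) → ℝ :=
  Sum.elim (entries θ.1) (entries θ.2)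

/-- Proper algebraic subsets of the parameter space: proper subsets defined in it by polynomial
equations. -/
def IsProperAlgebraicSubset (A : Set (Matrix V V ℝ × Matrix V V ℝ)) : Prop :=
  (∃ P : Set (MvPolynomial ((V × V) ⊕ (V × V)) ℝ),
    A = {θ | θ ∈ G.Theta ∧ ∀ p ∈ P, MvPolynomial.eval (pairEntries θ) p = 0}) ∧
  A ≠ G.Theta

/-- Rational identifiability: outside a proper algebraic subset, a rational map defined there
recovers the parameters from the covariance matrix. -/
def RationallyIdentifiable : Prop :=
  ∃ A, G.IsProperAlgebraicSubset A ∧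
    ∃ ψ : RationalMap (V × V) ((V × V) ⊕ (V × V)),
      ∀ θ ∈ G.Theta \ A,
        ψ.IsDefinedAt (entries (phi θ)) ∧ ψ.eval (entries (phi θ)) = pairEntries θ

/-- All fibers outside a proper algebraic subset are infinite. -/
def GenericallyInfiniteToOne : Prop :=
  ∃ A, G.IsProperAlgebraicSubset A ∧ ∀ θ ∈ G.Theta \ A, (G.fiber θ).Infinite

end Model

end MixedGraph

/- A trek system for the weak criterion becomes a half-trek system when every source is replaced
by the left top of its trek. The new sources that are half-trek reachable from `v` are old
sources, and membership of unreachable nodes in `Y_v` matters neither for the order nor for mutual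
pairs.

Identifiability. For `Σ = φ(Λ, Ω)` one has `(I - Λ)ᵀ Σ (I - Λ) = Ω`. Row `w ∈ Y_v` of this
equation is linear in column `v` of `Λ` once column `w` is known, and if `w` is not half-trek
reachable from `v`, it may be replaced by the same row of `Σ (I - Λ)`, which vanishes at `v`. The
system is injective where the matrix with rows of `Ω` at the parents of `v` and rows of `I - Λ`
elsewhere is invertible. A determinant of this kind is a nonzero polynomial if and only if there
is a system of half-treks without sided intersection: disjoint paths give a nonzero
specialization, and a nonzero term of the Leibniz expansion gives paths along the cycles of its
permutation.

Infinite fibers. Moving `Λ` in the direction `K` keeps `φ` constant if `Ω` moves by `-(M + Mᵀ)`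
for `M = Ω (I - Λ)⁻¹ K`, which is admissible if `M + Mᵀ` vanishes at all unlinked pairs of nodes.
This is a linear system for `K`. If it had only the zero solution, a maximal minor would be
nonzero, and so would be all diagonal blocks, one for each column of `Λ`, of some arrangement of
its rows. The blocks yield sets `Y_v` that satisfy the criterion. A pair `v ∈ Y_w`, `w ∈ Y_v`
would use both copies `(v, w)` and `(w, v)` of one equation, hence two equal rows. So there is a
nonzero solution with polynomial entries, and its integral curves lie in the fibers. -/

open Filter Topology
open scoped Matrix

namespace MixedGraph

section HalfTreks

variable {V : Type*} {G : MixedGraph V}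

theorem DiPath.source_mem_nodes {v w : V} (p : G.DiPath v w) : v ∈ p.nodes := by
  cases p <;> simp [DiPath.nodes]

theorem DiPath.target_mem_nodes {v w : V} (p : G.DiPath v w) : w ∈ p.nodes := by
  induction p with
  | nil v => simp [DiPath.nodes]
  | cons _ p ih => simp [DiPath.nodes, ih]

/-- Concatenation of directed paths, used to extend half-treks along directed paths. -/
def DiPath.append : {u v w : V} → G.DiPath u v → G.DiPath v w → G.DiPath u w
  | _, _, _, .nil _, q => q
  | _, _, _, .cons h p, q => .cons h (p.append q)

theorem Trek.isHalfTrek_iff {v w : V} {π : G.Trek v w} : π.IsHalfTrek ↔ π.left = {v} := by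
  have hv : v ∈ π.left := π.leftPath.target_mem_nodes
  refine ⟨fun h => ?_, fun h => by simp [Trek.IsHalfTrek, h]⟩
  obtain ⟨a, ha⟩ := Set.ncard_eq_one.mp h
  rw [ha, Set.mem_singleton_iff] at hv
  rw [ha, hv]

theorem Trek.IsHalfTrek.topL_eq {v w : V} {π : G.Trek v w} (h : π.IsHalfTrek) : π.topL = v := by
  have htop : π.topL ∈ π.left := π.leftPath.source_mem_nodes
  rwa [Trek.isHalfTrek_iff.mp h] at htop

variable (G) in
/-- Two nodes are linked if they are equal or joined by a bidirected edge. This is the relation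
between the two tops of a trek, and it is the pattern of the entries of `Ω` that need not vanish. -/
def Linked (v w : V) : Prop := v = w ∨ G.B v w

theorem Linked.refl (v : V) : G.Linked v v := Or.inl rfl

theorem Linked.symm {v w : V} (h : G.Linked v w) : G.Linked w v := h.imp Eq.symm (G.B_symm v w)

/-- The half-trek formed by a source, a link and a directed path. -/
def Trek.ofPath {v t w : V} (h : G.Linked v t) (p : G.DiPath t w) : G.Trek v w :=
  ⟨v, t, .nil v, p, h⟩

theorem Trek.isHalfTrek_ofPath {v t w : V} (h : G.Linked v t) (p : G.DiPath t w) :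
    (Trek.ofPath h p).IsHalfTrek :=
  Trek.isHalfTrek_iff.mpr rfl

theorem Trek.IsHalfTrek.linked {v w : V} {π : G.Trek v w} (h : π.IsHalfTrek) :
    G.Linked v π.topR := by
  simpa only [Linked, h.topL_eq] using π.link

variable (G) in
/-- `G.Reach v w` says that there is a half-trek from `v` to `w`. In contrast to `w ∈ G.htr v`, it
holds for `w = v` and for the siblings `w` of `v`. -/
def Reach (v w : V) : Prop := ∃ t, G.Linked v t ∧ Nonempty (G.DiPath t w)

theorem reach_iff_exists_isHalfTrek {v w : V} :
    G.Reach v w ↔ ∃ π : G.Trek v w, π.IsHalfTrek := by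
  constructor
  · rintro ⟨t, h, ⟨p⟩⟩
    exact ⟨Trek.ofPath h p, Trek.isHalfTrek_ofPath h p⟩
  · rintro ⟨π, h⟩
    exact ⟨π.topR, h.linked, ⟨π.rightPath⟩⟩

theorem Linked.reach {v w : V} (h : G.Linked v w) : G.Reach v w := ⟨w, h, ⟨.nil w⟩⟩

theorem Reach.trans_diPath {v u w : V} (h : G.Reach v u) (p : G.DiPath u w) : G.Reach v w := by
  obtain ⟨t, ht, ⟨q⟩⟩ := h
  exact ⟨t, ht, ⟨q.append p⟩⟩

theorem Reach.trans_edge {v u w : V} (h : G.Reach v u) (e : G.D u w) : G.Reach v w :=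
  h.trans_diPath (.cons e (.nil w))

theorem mem_htr_iff {v w : V} : w ∈ G.htr v ↔ ¬ G.Linked w v ∧ G.Reach v w := by
  rw [reach_iff_exists_isHalfTrek]
  rfl

end HalfTreks

section HalfTrekCriterion

variable {V : Type*} {G : MixedGraph V}

variable (G) in
/-- A system of half-treks with target set `P` and without sided intersection, indexed by the
targets: `src p` is the source of the half-trek that ends in `p`. -/
def HalfTrekLinking (P : Set V) (src : P → V) : Prop :=
  Function.Injective src ∧ ∃ (top : P → V) (path : ∀ p : P, G.DiPath (top p) p),
    (∀ p, G.Linked (src p) (top p)) ∧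
    Pairwise fun p q => Disjoint (path p).nodes (path q).nodes

theorem TrekSystem.NoSidedIntersection.topL_injective {X P : Set V} {S : G.TrekSystem X P}
    (hS : S.NoSidedIntersection) : Function.Injective fun x : X => (S.trek x).topL := by
  intro x y (hxy : (S.trek x).topL = (S.trek y).topL)
  by_contra hne
  have hx : (S.trek x).topL ∈ (S.trek x).left := (S.trek x).leftPath.source_mem_nodes
  have hy : (S.trek y).topL ∈ (S.trek y).left := (S.trek y).leftPath.source_mem_nodes
  exact Set.notMem_empty _ ((hS x y hne).1.subset ⟨hx, hxy ▸ hy⟩)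

theorem TrekSystem.NoSidedIntersection.halfTrekLinking_topL {X P : Set V} {S : G.TrekSystem X P}
    (hS : S.NoSidedIntersection) :
    G.HalfTrekLinking P fun p => (S.trek (S.target.symm p)).topL := by
  have hright : ∀ p : P, ∃ (t : V) (q : G.DiPath t p),
      G.Linked (S.trek (S.target.symm p)).topL t ∧
        q.nodes = (S.trek (S.target.symm p)).right := by
    intro p
    obtain ⟨x, rfl⟩ := S.target.surjective p
    rw [Equiv.symm_apply_apply]
    exact ⟨(S.trek x).topR, (S.trek x).rightPath, (S.trek x).link, rfl⟩
  choose top path hlink hnodes using hright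
  refine ⟨hS.topL_injective.comp S.target.symm.injective, top, path, hlink, fun p q hpq => ?_⟩
  simp only [hnodes, Set.disjoint_iff_inter_eq_empty]
  exact (hS _ _ (S.target.symm.injective.ne hpq)).2

theorem HalfTrekLinking.exists_trekSystem {P : Set V} {src : P → V}
    (h : G.HalfTrekLinking P src) :
    ∃ S : G.TrekSystem (Set.range src) P, S.NoSidedIntersection ∧
      ∀ y, (S.trek y).IsHalfTrek := by
  obtain ⟨hinj, top, path, hlink, hdisj⟩ := h
  let e : Set.range src ≃ P := (Equiv.ofInjective src hinj).symm
  have hlink' : ∀ y : Set.range src, G.Linked y (top (e y)) := fun y =>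
    Equiv.apply_ofInjective_symm hinj y ▸ hlink (e y)
  refine ⟨⟨e, fun y => Trek.ofPath (hlink' y) (path (e y))⟩, fun y z hyz => ⟨?_, ?_⟩,
    fun y => Trek.isHalfTrek_ofPath _ _⟩
  · exact Set.singleton_inter_eq_empty.mpr fun h => hyz (Subtype.ext h)
  · exact Set.disjoint_iff_inter_eq_empty.mp (hdisj (e.injective.ne hyz))

theorem halfTrekCriterion_iff {Y : Set V} {v : V} :
    G.HalfTrekCriterion Y v ↔ (∀ y ∈ Y, ¬ G.Linked y v) ∧
      ∃ src : G.pa v → V, Set.range src = Y ∧ G.HalfTrekLinking (G.pa v) src := by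
  rw [HalfTrekCriterion, ← Set.disjoint_iff_inter_eq_empty, Set.disjoint_left]
  constructor
  · rintro ⟨-, hY, S, hS, hhalf⟩
    have hsrc : (fun p => (S.trek (S.target.symm p)).topL) = fun p => (S.target.symm p : V) :=
      funext fun p => (hhalf _).topL_eq
    refine ⟨hY, _, ?_, hS.halfTrekLinking_topL⟩
    rw [hsrc]
    exact (S.target.symm.surjective.range_comp _).trans Subtype.range_coe
  · rintro ⟨hY, src, rfl, hlinking⟩
    refine ⟨?_, hY, hlinking.exists_trekSystem⟩
    exact Nat.card_range_of_injective hlinking.1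

theorem HalfTrekCriterion.weak {Y : Set V} {v : V} (h : G.HalfTrekCriterion Y v) :
    G.WeakHalfTrekCriterion Y v := by
  obtain ⟨hcard, hY, S, hS, hhalf⟩ := h
  exact ⟨hcard, hY, S, hS, fun y _ => hhalf y⟩

/-- Every source is replaced by the left top of its trek. A source in `htr v` starts a half-trek and
is its own top; the top of any other source is not reachable from `v`, as otherwise so would be the
source. -/
theorem WeakHalfTrekCriterion.exists_halfTrekCriterion {Y : Set V} {v : V}
    (h : G.WeakHalfTrekCriterion Y v) :
    ∃ Y', G.HalfTrekCriterion Y' v ∧ Y' ∩ G.htr v ⊆ Y ∩ G.htr v := by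
  obtain ⟨-, hY, S, hS, hhalf⟩ := h
  have hunlinked : ∀ y : Y, ¬ G.Linked (y : V) v := fun y =>
    Set.disjoint_left.mp (Set.disjoint_iff_inter_eq_empty.mpr hY) y.2
  have htop : ∀ y : Y, (S.trek y).topL = y ∨ ¬ G.Reach v (S.trek y).topL := by
    intro y
    by_cases hy : (y : V) ∈ G.htr v
    · exact Or.inl (hhalf y hy).topL_eq
    · exact Or.inr fun hreach => hy <|
        mem_htr_iff.mpr ⟨hunlinked y, hreach.trans_diPath (S.trek y).leftPath⟩
  refine ⟨_, halfTrekCriterion_iff.mpr ⟨?_, _, rfl, hS.halfTrekLinking_topL⟩, ?_⟩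
  · rintro _ ⟨p, rfl⟩ hlinked
    rcases htop (S.target.symm p) with heq | hreach
    · exact hunlinked _ ((congrArg (G.Linked · v) heq).mp hlinked)
    · exact hreach hlinked.symm.reach
  · rintro _ ⟨⟨p, rfl⟩, hhtr⟩
    refine ⟨?_, hhtr⟩
    rcases htop (S.target.symm p) with heq | hreach
    · exact (congrArg (· ∈ Y) heq).mpr (S.target.symm p).2
    · exact absurd (mem_htr_iff.mp hhtr).2 hreach

theorem HalfTrekCriterion.reach {Y : Set V} {v w : V} (h : G.HalfTrekCriterion Y v)
    (hw : w ∈ Y) : G.Reach w v := by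
  obtain ⟨-, src, rfl, -, top, path, hlink, -⟩ := halfTrekCriterion_iff.mp h
  obtain ⟨p, rfl⟩ := hw
  exact Reach.trans_edge ⟨top p, hlink p, ⟨path p⟩⟩ p.2

theorem HalfTrekCriterion.mem_htr_of_mem {Y Y' : Set V} {v w : V} (h : G.HalfTrekCriterion Y v)
    (h' : G.HalfTrekCriterion Y' w) (hw : w ∈ Y) (hv : v ∈ Y') : v ∈ G.htr w :=
  mem_htr_iff.mpr ⟨(halfTrekCriterion_iff.mp h').1 v hv, h.reach hw⟩

theorem weakHTCIdentifiable_iff : G.WeakHTCIdentifiable ↔ G.HTCIdentifiable := by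
  constructor
  · rintro ⟨Y, hY, r, hr, hord⟩
    choose Y' hY' hsub using fun v => (hY v).exists_halfTrekCriterion
    exact ⟨Y', hY', r, hr, fun v w hw => hord v w (hsub v hw)⟩
  · rintro ⟨Y, hY, hord⟩
    exact ⟨Y, fun v => (hY v).weak, hord⟩

theorem weakHTCInfiniteToOne_iff : G.WeakHTCInfiniteToOne ↔ G.HTCInfiniteToOne := by
  constructor
  · exact fun h Y => (h Y).imp_left fun ⟨v, hv⟩ => ⟨v, fun hv' => hv hv'.weak⟩
  · intro h Y
    by_contra! ⟨hY, hpair⟩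
    choose Y' hY' hsub using fun v => (hY v).exists_halfTrekCriterion
    rcases h Y' with ⟨v, hv⟩ | ⟨v, w, hvw, hv, hw⟩
    · exact hv (hY' v)
    · have hvY : v ∈ Y w := (hsub w ⟨hv, (hY' v).mem_htr_of_mem (hY' w) hw hv⟩).1
      have hwY : w ∈ Y v := (hsub v ⟨hw, (hY' w).mem_htr_of_mem (hY' v) hv hw⟩).1
      exact hpair v w hvw hvY hwY

end HalfTrekCriterion

end MixedGraph

section RealAlgebra

theorem posDef_of_sum_abs_lt_diag {n : Type*} [Fintype n] [DecidableEq n] {A : Matrix n n ℝ}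
    (hA : A.IsHermitian) (h : ∀ i, ∑ j ∈ Finset.univ.erase i, |A i j| < A i i) : A.PosDef := by
  refine hA.posDef_iff_eigenvalues_pos.mpr fun i => ?_
  have hev : Module.End.HasEigenvalue (Matrix.toLin' A) (hA.eigenvalues i) := by
    rw [Module.End.hasEigenvalue_iff_mem_spectrum, Matrix.spectrum_toLin']
    exact hA.eigenvalues_mem_spectrum_real i
  obtain ⟨k, hk⟩ := eigenvalue_mem_ball hev
  simp only [Metric.mem_closedBall, Real.dist_eq, Real.norm_eq_abs] at hk
  linarith [neg_abs_le (hA.eigenvalues i - A k k), h k]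

theorem eq_zero_of_eventually_eval_eq_zero {σ : Type*} [Finite σ] {p : MvPolynomial σ ℝ}
    {a : σ → ℝ} (h : ∀ᶠ x in 𝓝 a, MvPolynomial.eval x p = 0) : p = 0 := by
  have := Fintype.ofFinite σ
  obtain ⟨ε, hε, hball⟩ := Metric.eventually_nhds_iff_ball.mp h
  refine MvPolynomial.funext_set (fun i => Metric.ball (a i) ε) (fun i => ?_) fun x hx => ?_
  · exact infinite_of_mem_nhds (a i) (Metric.ball_mem_nhds _ hε)
  · rw [map_zero]
    exact hball x (by rwa [ball_pi a hε])

theorem mvPolynomial_eval_det {n σ R : Type*} [Fintype n] [DecidableEq n] [CommRing R] (x : σ → R)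
    (M : Matrix n n (MvPolynomial σ R)) :
    MvPolynomial.eval x M.det = (M.map (MvPolynomial.eval x)).det :=
  RingHom.map_det _ _

end RealAlgebra

namespace MixedGraph

section Projection

/-- Pairs of matrices over `R`; the parameter space consists of such pairs over `ℝ`. -/
abbrev MatrixPair (V R : Type*) := Matrix V V R × Matrix V V R

/-- The index type of the entries of a pair of matrices, those of the first matrix on the left. -/
abbrev Coord (V : Type*) := (V × V) ⊕ (V × V)

variable {V : Type*} (G : MixedGraph V)

/-- For `R = ℝ` the linear space spanned by the parameter space: the pairs `(Λ, Ω)` with the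
required zeros and `Ω` symmetric, without the conditions of invertibility and positivity. -/
def support {R : Type*} [Zero R] : Set (MatrixPair V R) :=
  {θ | (∀ v w, ¬ G.D v w → θ.1 v w = 0) ∧ θ.2.IsSymm ∧ ∀ v w, ¬ G.Linked v w → θ.2 v w = 0}

open Classical in
/-- The projection of the space of all pairs of matrices, in coordinates, onto `G.support`, the
second matrix being symmetrized. -/
noncomputable def project (a : Coord V → ℝ) : MatrixPair V ℝ :=
  (Matrix.of fun v w => if G.D v w then a (Sum.inl (v, w)) else 0,
    Matrix.of fun v w => if G.Linked v w then
      (1 / 2) * (a (Sum.inr (v, w)) + a (Sum.inr (w, v))) else 0)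

open Classical in
/-- The substitution of polynomials that corresponds to `G.project`. It carries a polynomial to
zero precisely if the polynomial vanishes on the parameter space. -/
noncomputable def projectHom : MvPolynomial (Coord V) ℝ →ₐ[ℝ] MvPolynomial (Coord V) ℝ :=
  MvPolynomial.aeval <| Sum.elim
    (fun e => if G.D e.1 e.2 then MvPolynomial.X (Sum.inl e) else 0)
    (fun e => if G.Linked e.1 e.2 then MvPolynomial.C (1 / 2) *
      (MvPolynomial.X (Sum.inr e) + MvPolynomial.X (Sum.inr e.swap)) else 0)

variable {G}

theorem project_mem_support (a : Coord V → ℝ) : G.project a ∈ G.support := by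
  refine ⟨fun v w h => by simp [project, h], ?_, fun v w h => by simp [project, h]⟩
  ext v w
  classical exact if_congr ⟨.symm, .symm⟩ (by rw [add_comm]) rfl

theorem project_pairEntries {θ : MatrixPair V ℝ} (h : θ ∈ G.support) :
    G.project (pairEntries θ) = θ := by
  obtain ⟨hD, hsymm, hB⟩ := h
  refine Prod.ext (Matrix.ext fun v w => ?_) (Matrix.ext fun v w => ?_)
  · by_cases h : G.D v w
    · simp [project, pairEntries, entries, h]
    · simp [project, h, hD v w h]
  · by_cases h : G.Linked v w
    · simp only [project, pairEntries, entries, h, if_true, Matrix.of_apply, Sum.elim_inr,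
        hsymm.apply v w]
      ring
    · simp [project, h, hB v w h]

theorem eval_projectHom (a : Coord V → ℝ) (p : MvPolynomial (Coord V) ℝ) :
    MvPolynomial.eval a (G.projectHom p) = MvPolynomial.eval (pairEntries (G.project a)) p := by
  suffices h : (MvPolynomial.aeval a).comp G.projectHom =
      MvPolynomial.aeval (R := ℝ) (pairEntries (G.project a)) from DFunLike.congr_fun h p
  refine MvPolynomial.algHom_ext fun i => ?_
  rcases i with ⟨v, w⟩ | ⟨v, w⟩ <;>
  · simp only [projectHom, AlgHom.comp_apply, MvPolynomial.aeval_X, Sum.elim_inl, Sum.elim_inr,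
      pairEntries, entries, project, Matrix.of_apply]
    split_ifs <;> simp

theorem projectHom_ne_zero_of_mem_support {f : MvPolynomial (Coord V) ℝ} {η : MatrixPair V ℝ}
    (hη : η ∈ G.support) (hf : MvPolynomial.eval (pairEntries η) f ≠ 0) : G.projectHom f ≠ 0 := by
  rintro h
  rw [← project_pairEntries hη, ← eval_projectHom, h, map_zero] at hf
  exact hf rfl

end Projection

section Generic

variable {V : Type*} [Fintype V] [DecidableEq V] {G : MixedGraph V}

theorem Theta_subset_support : G.Theta ⊆ G.support := fun _ hθ =>
  ⟨hθ.1.1, by simpa [Matrix.IsHermitian, Matrix.IsSymm] using hθ.2.1.1,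
    fun v w h => hθ.2.2 v w (not_or.mp h).1 (not_or.mp h).2⟩

theorem apply_eq_zero_of_not_linked {θ : MatrixPair V ℝ} (hθ : θ ∈ G.Theta) {v w : V}
    (h : ¬ G.Linked v w) : θ.2 v w = 0 :=
  (Theta_subset_support hθ).2.2 v w h

omit [Fintype V] in
theorem zero_one_mem_support : ((0, 1) : MatrixPair V ℝ) ∈ G.support :=
  ⟨fun _ _ _ => rfl, Matrix.isSymm_one, fun _ _ h => Matrix.one_apply_ne (not_or.mp h).1⟩

omit [Fintype V] [DecidableEq V] in
theorem continuous_project : Continuous G.project := by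
  refine Continuous.prodMk ?_ ?_ <;>
  · refine continuous_matrix fun v w => ?_
    simp only [Matrix.of_apply]
    split_ifs <;> fun_prop

theorem eventually_project_mem_Theta :
    ∀ᶠ a in 𝓝 (pairEntries ((0, 1) : MatrixPair V ℝ)), G.project a ∈ G.Theta := by
  have hlim : Tendsto G.project (𝓝 (pairEntries (0, 1))) (𝓝 (0, 1)) := by
    simpa only [project_pairEntries zero_one_mem_support] using
      (continuous_project (G := G)).tendsto (pairEntries (0, 1))
  have hdet : ∀ᶠ θ : MatrixPair V ℝ in 𝓝 (0, 1), (1 - θ.1).det ≠ 0 :=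
    ContinuousAt.eventually_ne (by fun_prop) (by simp)
  have hdom : ∀ᶠ θ : MatrixPair V ℝ in 𝓝 (0, 1),
      ∀ v, ∑ w ∈ Finset.univ.erase v, |θ.2 v w| < θ.2 v v := by
    refine eventually_all.mpr fun v => ?_
    have hleft : Continuous fun θ : MatrixPair V ℝ => ∑ w ∈ Finset.univ.erase v, |θ.2 v w| :=
      continuous_finsetSum _ fun w _ => (continuous_snd.matrix_elem v w).abs
    refine hleft.tendsto _ |>.eventually_lt ((continuous_snd.matrix_elem v v).tendsto _) ?_
    rw [Finset.sum_eq_zero fun w hw => by simp [(Finset.ne_of_mem_erase hw).symm]]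
    simp
  filter_upwards [hlim.eventually hdet, hlim.eventually hdom] with a hdet hdom
  obtain ⟨hD, hsymm, hB⟩ := project_mem_support (G := G) a
  exact ⟨⟨hD, (Matrix.isUnit_iff_isUnit_det _).mpr hdet.isUnit⟩,
    posDef_of_sum_abs_lt_diag (by simpa [Matrix.IsHermitian] using hsymm.eq) hdom,
    fun v w hne hnB => hB v w (not_or.mpr ⟨hne, hnB⟩)⟩

theorem projectHom_ne_zero_iff {f : MvPolynomial (Coord V) ℝ} :
    G.projectHom f ≠ 0 ↔ ∃ θ ∈ G.Theta, MvPolynomial.eval (pairEntries θ) f ≠ 0 := by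
  constructor
  · intro hf
    by_contra! hzero
    refine hf (eq_zero_of_eventually_eval_eq_zero (a := pairEntries (0, 1)) ?_)
    filter_upwards [eventually_project_mem_Theta] with a ha
    rw [eval_projectHom, hzero _ ha]
  · rintro ⟨θ, hθ, hf⟩
    exact projectHom_ne_zero_of_mem_support (Theta_subset_support hθ) hf

variable (G) in
/-- The filter of sets that contain the complement of a proper algebraic subset of the parameter
space, so that `∀ᶠ θ in G.generic, p θ` says that `p` holds for generic parameters. -/
def generic : Filter (MatrixPair V ℝ) where
  sets := {s | ∃ f : MvPolynomial (Coord V) ℝ, G.projectHom f ≠ 0 ∧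
    ∀ θ ∈ G.Theta, MvPolynomial.eval (pairEntries θ) f ≠ 0 → θ ∈ s}
  univ_sets := ⟨1, by simp, fun _ _ _ => trivial⟩
  sets_of_superset := by
    rintro s t ⟨f, hf, hs⟩ hst
    exact ⟨f, hf, fun θ hθ hfθ => hst (hs θ hθ hfθ)⟩
  inter_sets := by
    rintro s t ⟨f, hf, hs⟩ ⟨g, hg, ht⟩
    refine ⟨f * g, by simp [hf, hg], fun θ hθ hfg => ?_⟩
    rw [map_mul, mul_ne_zero_iff] at hfg
    exact ⟨hs θ hθ hfg.1, ht θ hθ hfg.2⟩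

instance : (generic G).NeBot := by
  refine ⟨fun h => ?_⟩
  obtain ⟨f, hf, hempty⟩ := h ▸ Filter.mem_bot (s := (∅ : Set (MatrixPair V ℝ)))
  obtain ⟨θ, hθ, hfθ⟩ := projectHom_ne_zero_iff.mp hf
  exact hempty θ hθ hfθ

theorem eventually_mem_Theta : ∀ᶠ θ in G.generic, θ ∈ G.Theta :=
  ⟨1, by simp, fun _ hθ _ => hθ⟩

theorem eventually_eval_ne_zero {f : MvPolynomial (Coord V) ℝ} (hf : G.projectHom f ≠ 0) :
    ∀ᶠ θ in G.generic, MvPolynomial.eval (pairEntries θ) f ≠ 0 :=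
  ⟨f, hf, fun _ _ hfθ => hfθ⟩

theorem exists_isProperAlgebraicSubset {p : MatrixPair V ℝ → Prop}
    (h : ∀ᶠ θ in G.generic, p θ) :
    ∃ A, G.IsProperAlgebraicSubset A ∧ ∀ θ ∈ G.Theta \ A, p θ := by
  obtain ⟨f, hf, hp⟩ := h
  obtain ⟨θ, hθ, hfθ⟩ := projectHom_ne_zero_iff.mp hf
  refine ⟨{θ | θ ∈ G.Theta ∧ ∀ q ∈ ({f} : Set _), MvPolynomial.eval (pairEntries θ) q = 0},
    ⟨⟨_, rfl⟩, fun hA => hfθ ((hA.symm.subset hθ).2 f rfl)⟩, fun η hη => hp η hη.1 fun hfη => ?_⟩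
  exact hη.2 ⟨hη.1, by simpa using hfη⟩

end Generic

end MixedGraph

section SymmetricMatchings

theorem det_add_smul_single {R : Type*} [CommRing R] {n : ℕ}
    (A : Matrix (Fin (n + 1)) (Fin (n + 1)) R) (i : Fin (n + 1)) (s : R) :
    (A + s • Matrix.single i i 1).det = A.det + s * (A.submatrix i.succAbove i.succAbove).det := by
  have hrow : A + s • Matrix.single i i 1 = A.updateRow i (A i + s • Pi.single i 1) := by
    ext k j
    obtain rfl | hk := eq_or_ne k i
    · simp [Matrix.single_apply, Pi.single_apply, eq_comm]
    · simp [Matrix.updateRow_ne hk, hk.symm]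
  rw [hrow, Matrix.det_updateRow_add, Matrix.updateRow_eq_self, Matrix.det_updateRow_smul,
    ← Matrix.adjugate_apply, Matrix.adjugate_fin_succ_eq_det_submatrix,
    Even.neg_one_pow (Even.add_self _), one_mul]

theorem det_one_submatrix_ne_zero {V m K : Type*} [DecidableEq V] [Fintype m] [DecidableEq m]
    [Field K] {f g : m → V} (hf : Function.Injective f) (hg : Function.Injective g)
    (h : Set.range f ⊆ Set.range g) : ((1 : Matrix V V K).submatrix f g).det ≠ 0 := by
  choose σ hσ using fun i => h (Set.mem_range_self i)
  have hσinj : Function.Injective σ := fun a b hab => hf (by rw [← hσ a, ← hσ b, hab])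
  let e : Equiv.Perm m := Equiv.ofBijective σ (Finite.injective_iff_bijective.mp hσinj)
  have hperm : (1 : Matrix V V K).submatrix f g = (1 : Matrix m m K).submatrix e id := by
    ext a b
    simp only [Matrix.submatrix_apply, Matrix.one_apply, ← hσ a, hg.eq_iff, id, e,
      Equiv.ofBijective_apply]
  rw [hperm, Matrix.det_permute, Matrix.det_one, mul_one]
  rcases Int.units_eq_one_or e.sign with he | he <;> simp [he]

theorem exists_isSymm_det_submatrix_ne_zero {V K : Type*} [Field K] {E : V → V → Prop}
    (hrefl : ∀ v, E v v) (hsymm : ∀ v w, E v w → E w v) {n : ℕ} {f g : Fin n → V}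
    (hf : Function.Injective f) (hg : Function.Injective g) (hE : ∀ i, E (f i) (g i)) :
    ∃ M : Matrix V V K, M.IsSymm ∧ (∀ v w, ¬ E v w → M v w = 0) ∧ (M.submatrix f g).det ≠ 0 := by
  classical
  induction n with
  | zero => exact ⟨0, Matrix.isSymm_zero, fun _ _ _ => rfl, by simp⟩
  | succ n ih =>
    by_cases h : Set.range f ⊆ Set.range g
    · refine ⟨1, Matrix.isSymm_one, fun v w hvw => Matrix.one_apply_ne ?_,
        det_one_submatrix_ne_zero hf hg h⟩
      rintro rfl
      exact hvw (hrefl _)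
    obtain ⟨_, ⟨i, rfl⟩, hi⟩ := Set.not_subset.mp h
    obtain ⟨M, hM, hME, hdet⟩ := ih (hf.comp i.succAbove_right_injective)
      (hg.comp i.succAbove_right_injective) fun j => hE _
    let N : Matrix V V K := Matrix.single (f i) (g i) 1 + Matrix.single (g i) (f i) 1
    have hN : N.IsSymm := by simp [N, Matrix.IsSymm, add_comm]
    have hNE : ∀ v w, ¬ E v w → N v w = 0 := fun v w hvw => by
      have hne : ¬ (f i = v ∧ g i = w) := by rintro ⟨rfl, rfl⟩; exact hvw (hE i)
      have hne' : ¬ (g i = v ∧ f i = w) := by rintro ⟨rfl, rfl⟩; exact hvw (hsymm _ _ (hE i))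
      simp [N, hne, hne']
    -- As `f i` is not a column, only one of the two entries of `N` lies in the submatrix.
    have hNsub : N.submatrix f g = Matrix.single i i 1 := by
      ext k j
      have hj : f i ≠ g j := fun h => hi ⟨j, h.symm⟩
      simp [N, Matrix.single_apply, hf.eq_iff, hg.eq_iff, hj]
    have hsub (s : K) : ((M + s • N).submatrix f g).det = (M.submatrix f g).det +
        s * (M.submatrix (f ∘ i.succAbove) (g ∘ i.succAbove)).det := by
      rw [Matrix.submatrix_add, Matrix.submatrix_smul, Pi.add_apply, Pi.add_apply, Pi.smul_apply,
        Pi.smul_apply, hNsub, det_add_smul_single, Matrix.submatrix_submatrix]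
    obtain ⟨s, hs⟩ : ∃ s : K, ((M + s • N).submatrix f g).det ≠ 0 := by
      by_cases h0 : (M.submatrix f g).det = 0
      · exact ⟨1, by rwa [hsub, h0, zero_add, one_mul]⟩
      · exact ⟨0, by rwa [hsub, zero_mul, add_zero]⟩
    exact ⟨M + s • N, hM.add (hN.smul s), fun v w hvw => by simp [hME v w hvw, hNE v w hvw], hs⟩

theorem exists_isSymm_mulVec_injOn {V P K : Type*} [Fintype V] [Finite P] [Field K]
    {E : V → V → Prop} (hrefl : ∀ v, E v v) (hsymm : ∀ v w, E v w → E w v) {f g : P → V}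
    (hf : Function.Injective f) (hg : Function.Injective g) (hE : ∀ i, E (f i) (g i)) :
    ∃ M : Matrix V V K, M.IsSymm ∧ (∀ v w, ¬ E v w → M v w = 0) ∧
      ∀ x : V → K, (∀ w ∉ Set.range g, x w = 0) → (∀ p, (M *ᵥ x) (f p) = 0) → x = 0 := by
  obtain ⟨n, ⟨e⟩⟩ := Finite.exists_equiv_fin P
  obtain ⟨M, hM, hME, hdet⟩ := exists_isSymm_det_submatrix_ne_zero (K := K) hrefl hsymm
    (hf.comp e.symm.injective) (hg.comp e.symm.injective) fun i => hE _
  refine ⟨M, hM, hME, fun x hx hMx => ?_⟩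
  have hrestrict : M.submatrix (f ∘ e.symm) (g ∘ e.symm) *ᵥ (x ∘ g ∘ e.symm) = 0 := by
    funext i
    refine Eq.trans ?_ (hMx (e.symm i))
    refine Fintype.sum_of_injective (g ∘ e.symm) (hg.comp e.symm.injective) _ _ (fun w hw => ?_)
      fun j => rfl
    rw [EquivLike.range_comp] at hw
    rw [hx w hw, mul_zero]
  have hzero := Matrix.eq_zero_of_mulVec_eq_zero hdet hrestrict
  funext w
  by_cases hw : w ∈ Set.range g
  · obtain ⟨p, rfl⟩ := hw
    simpa using congrFun hzero (e p)
  · exact hx w hw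

theorem exists_ne_zero_det_add_smul_ne_zero {n : Type*} [Fintype n] [DecidableEq n]
    {A : Matrix n n ℝ} (hA : A.det ≠ 0) (B : Matrix n n ℝ) :
    ∃ ε : ℝ, ε ≠ 0 ∧ (A + ε • B).det ≠ 0 := by
  have hcont : Continuous fun ε : ℝ => (A + ε • B).det := by fun_prop
  have hnear : ∀ᶠ ε in 𝓝[≠] (0 : ℝ), (A + ε • B).det ≠ 0 :=
    (hcont.tendsto 0).eventually_ne (by simpa using hA) |>.filter_mono nhdsWithin_le_nhds
  obtain ⟨ε, hdet, hε⟩ := (hnear.and self_mem_nhdsWithin).exists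
  exact ⟨ε, hε, hdet⟩

end SymmetricMatchings

theorem exists_perm_of_pairwise_disjoint {α ι : Type*} {s : ι → Set α}
    (hs : Pairwise (Function.onFun Disjoint s)) (ρ : ι → Equiv.Perm α)
    (hρ : ∀ i, ∀ a ∉ s i, ρ i a = a) :
    ∃ σ : Equiv.Perm α, (∀ i, ∀ a ∈ s i, σ a = ρ i a) ∧ ∀ a, (∀ i, a ∉ s i) → σ a = a := by
  classical
  have hmem (i : ι) (a : α) : ρ i a ∈ s i ↔ a ∈ s i := by
    refine ⟨fun h => by_contra fun ha => ha (hρ i a ha ▸ h), fun h => by_contra fun ha => ?_⟩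
    exact ha (((ρ i).injective (hρ i _ ha)).symm ▸ h)
  let σ : Equiv.Perm (⋃ i, s i) := (Set.unionEqSigmaOfDisjoint hs).symm.permCongr
    (Equiv.Perm.sigmaCongrRight fun i => (ρ i).subtypePerm (hmem i))
  have hσ (x : Σ i, s i) : (σ (Set.sigmaToiUnion s x) : α) = ρ x.1 x.2 := by
    have hx : Set.unionEqSigmaOfDisjoint hs (Set.sigmaToiUnion s x) = x :=
      Equiv.symm_apply_apply (Set.unionEqSigmaOfDisjoint hs).symm x
    rw [Equiv.permCongr_apply, Equiv.symm_symm, hx]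
    rfl
  refine ⟨Equiv.Perm.ofSubtype σ, fun i a ha => ?_, fun a ha => ?_⟩
  · rw [Equiv.Perm.ofSubtype_apply_of_mem _ (Set.mem_iUnion_of_mem i ha)]
    exact hσ ⟨i, a, ha⟩
  · exact Equiv.Perm.ofSubtype_apply_of_not_mem _ (by simpa using ha)

namespace MixedGraph

section Linking

variable {V : Type*} {G : MixedGraph V}

-- The permutation rotates a simple path inside `p` from `u` to `b`.
theorem DiPath.exists_perm {a b : V} (p : G.DiPath a b) {u : V} (hu : u ∈ p.nodes) :
    ∃ ρ : Equiv.Perm V, ρ b = u ∧ (∀ w ∉ p.nodes, ρ w = w) ∧ ∀ w ≠ b, ρ w = w ∨ G.D w (ρ w) := by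
  classical
  induction p generalizing u with
  | nil v =>
    obtain rfl := hu
    exact ⟨1, rfl, fun _ _ => rfl, fun _ _ => Or.inl rfl⟩
  | @cons a v b h p ih =>
    by_cases hu' : u ∈ p.nodes
    · obtain ⟨ρ, hb, hfix, hρ⟩ := ih hu'
      exact ⟨ρ, hb, fun w hw => hfix w fun hw' => hw (Or.inr hw'), hρ⟩
    obtain rfl : u = a := hu.resolve_right hu'
    obtain ⟨ρ, hb, hfix, hρ⟩ := ih p.source_mem_nodes
    refine ⟨Equiv.swap v u * ρ, by simp [hb], fun w hw => ?_, fun w hw => ?_⟩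
    · have hwp : w ∉ p.nodes := fun h => hw (Or.inr h)
      have hwv : w ≠ v := fun h => hwp (h ▸ p.source_mem_nodes)
      rw [Equiv.Perm.mul_apply, hfix w hwp,
        Equiv.swap_apply_of_ne_of_ne hwv fun h => hw (Or.inl h)]
    · have hv : ρ w ≠ v := fun h => hw (ρ.injective (h.trans hb.symm : ρ w = ρ _))
      rw [Equiv.Perm.mul_apply]
      by_cases hwu : ρ w = u
      · obtain rfl : w = u := ρ.injective (hwu.trans (hfix u hu').symm)
        rw [hwu, Equiv.swap_apply_right]
        exact Or.inr h
      · rw [Equiv.swap_apply_of_ne_of_ne hv hwu]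
        exact hρ w hw

theorem exists_perm_of_disjoint_paths {P : Set V} {top : P → V} (path : ∀ p : P, G.DiPath (top p) p)
    (hdis : Pairwise fun p q => Disjoint (path p).nodes (path q).nodes) :
    ∃ ρ : Equiv.Perm V, (∀ p : P, ρ p = top p) ∧ ∀ w ∉ P, ρ w = w ∨ G.D w (ρ w) := by
  choose ρ htop hfix hρ using fun p : P => (path p).exists_perm (path p).source_mem_nodes
  obtain ⟨σ, hσ, hσfix⟩ := exists_perm_of_pairwise_disjoint hdis ρ hfix
  refine ⟨σ, fun p => by rw [hσ p p (path p).target_mem_nodes, htop], fun w hw => ?_⟩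
  by_cases h : ∃ p, w ∈ (path p).nodes
  · obtain ⟨p, hp⟩ := h
    rw [hσ p w hp]
    exact hρ p w fun h => hw (h ▸ p.2)
  · exact Or.inl (hσfix w (not_exists.mp h))

open Classical in
/-- The matrix with the rows `src p` of `Ω` in the positions `p ∈ P` and the rows of `I - Λ` in
the other positions. Its determinant detects half-trek linkings. -/
noncomputable def linkMatrix {R : Type*} [CommRing R] {P : Set V} (src : P → V)
    (Λ Ω : Matrix V V R) : Matrix V V R :=
  Matrix.of fun w u => if h : w ∈ P then Ω (src ⟨w, h⟩) u else (1 - Λ) w u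

theorem linkMatrix_of_mem {R : Type*} [CommRing R] {P : Set V} (src : P → V)
    (Λ Ω : Matrix V V R) (p : P) : linkMatrix src Λ Ω p = Ω (src p) := by
  funext u
  simp [linkMatrix]

theorem linkMatrix_of_notMem {R : Type*} [CommRing R] [DecidableEq V] {P : Set V} (src : P → V)
    (Λ Ω : Matrix V V R) {w : V} (hw : w ∉ P) : linkMatrix src Λ Ω w = (1 - Λ) w := by
  funext u
  simp [linkMatrix, hw, Matrix.one_apply]

theorem det_ne_zero_of_rows_eq_or_eq_single {K : Type*} [Field K] [Fintype V] [DecidableEq V]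
    {P : Set V} {src : P → V} {Ω A : Matrix V V K} {ρ : Equiv.Perm V}
    (hΩ : ∀ x : V → K, (∀ w ∉ Set.range fun p : P => ρ p, x w = 0) →
      (∀ p, (Ω *ᵥ x) (src p) = 0) → x = 0)
    (hAP : ∀ p : P, A p = Ω (src p)) {c : V → K} (hc : ∀ w, c w ≠ 0)
    (hA : ∀ w ∉ P, A w = Pi.single (ρ w) (c w)) : A.det ≠ 0 := by
  intro hdet
  obtain ⟨x, hx, hAx⟩ := Matrix.exists_mulVec_eq_zero_iff.mpr hdet
  refine hx (hΩ x (fun w hw => ?_) fun p => ?_)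
  · obtain ⟨u, rfl⟩ := ρ.surjective w
    have hu : u ∉ P := fun hu => hw ⟨⟨u, hu⟩, rfl⟩
    have hrow := congrFun hAx u
    rw [Matrix.mulVec, hA u hu, single_dotProduct] at hrow
    exact (mul_eq_zero.mp hrow).resolve_left (hc u)
  · have hrow := congrFun hAx p
    rwa [Matrix.mulVec, hAP] at hrow

theorem exists_mem_support_det_linkMatrix_ne_zero [Fintype V] [DecidableEq V] {P : Set V}
    {src : P → V} (h : G.HalfTrekLinking P src) :
    ∃ θ : MatrixPair V ℝ, θ ∈ G.support ∧ (linkMatrix src θ.1 θ.2).det ≠ 0 := by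
  classical
  obtain ⟨hsrc, top, path, hlink, hdis⟩ := h
  obtain ⟨ρ, hρP, hρ⟩ := exists_perm_of_disjoint_paths path hdis
  obtain rfl : (fun p : P => ρ p) = top := funext hρP
  obtain ⟨Ω, hsymm, hsupp, hΩ⟩ := exists_isSymm_mulVec_injOn (K := ℝ) Linked.refl
    (fun _ _ => Linked.symm) hsrc (ρ.injective.comp Subtype.val_injective) hlink
  let A : Matrix V V ℝ := Matrix.of fun w => if h : w ∈ P then Ω (src ⟨w, h⟩) else
    Pi.single (ρ w) (if ρ w = w then 1 else -1)
  have hA : A.det ≠ 0 := det_ne_zero_of_rows_eq_or_eq_single hΩ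
    (fun p => by ext; simp [A])
    (c := fun w => if ρ w = w then 1 else -1) (fun w => by split_ifs <;> norm_num)
    fun w hw => by ext; simp [A, hw]
  obtain ⟨ε, hε, hdet⟩ := exists_ne_zero_det_add_smul_ne_zero hA
    (Matrix.diagonal fun w => if w ∈ P ∨ ρ w = w then 0 else 1)
  let Λ : Matrix V V ℝ := Matrix.of fun w u => if w ∉ P ∧ ρ w ≠ w ∧ u = ρ w then ε⁻¹ else 0
  have hΛ : ∀ w u, ¬ G.D w u → Λ w u = 0 := by
    refine fun w u hwu => if_neg ?_
    rintro ⟨hw, hne, rfl⟩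
    exact hwu ((hρ w hw).resolve_left hne)
  refine ⟨(Λ, Ω), ⟨hΛ, hsymm, hsupp⟩, right_ne_zero_of_mul
    (a := (Matrix.diagonal fun w => if w ∈ P ∨ ρ w = w then 1 else ε).det) ?_⟩
  rw [← Matrix.det_mul]
  convert hdet using 2
  ext w u
  rw [Matrix.diagonal_mul]
  by_cases hw : w ∈ P
  · simp [linkMatrix, A, hw, Matrix.diagonal_apply]
  · rw [linkMatrix_of_notMem src Λ Ω hw]
    by_cases hρw : ρ w = w
    · simp [A, Λ, hw, hρw, Matrix.diagonal_apply, Matrix.one_apply, Pi.single_apply, eq_comm]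
    · simp only [hw, hρw, or_self, ↓reduceIte, ne_eq, Matrix.sub_apply, Matrix.one_apply,
        Matrix.of_apply, not_false_eq_true, true_and, mul_sub, mul_ite, mul_one, mul_zero, hε,
        mul_inv_cancel₀, Matrix.add_apply, ↓reduceDIte, Pi.single_apply, Matrix.smul_apply,
        Matrix.diagonal_apply, smul_eq_mul, Λ, A]
      split_ifs <;> ring

theorem linkMatrix_mulVec_of_mem {R : Type*} [CommRing R] [Fintype V] {P : Set V} (src : P → V)
    (Λ Ω : Matrix V V R) (x : V → R) (p : P) :
    (linkMatrix src Λ Ω *ᵥ x) p = (Ω *ᵥ x) (src p) := by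
  simp only [Matrix.mulVec, linkMatrix_of_mem]

theorem linkMatrix_mulVec_of_notMem {R : Type*} [CommRing R] [Fintype V] [DecidableEq V]
    {P : Set V} (src : P → V) (Λ Ω : Matrix V V R) (x : V → R) {w : V} (hw : w ∉ P) :
    (linkMatrix src Λ Ω *ᵥ x) w = ((1 - Λ) *ᵥ x) w := by
  simp only [Matrix.mulVec, linkMatrix_of_notMem src Λ Ω hw]

theorem map_linkMatrix {R S : Type*} [CommRing R] [CommRing S] (φ : R →+* S) {P : Set V}
    (src : P → V) (Λ Ω : Matrix V V R) :
    (linkMatrix src Λ Ω).map φ = linkMatrix src (Λ.map φ) (Ω.map φ) := by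
  classical
  ext w u
  by_cases h : w ∈ P
  · simp [linkMatrix, h]
  · simp [linkMatrix, h, Matrix.one_apply, apply_ite φ]

/-- The pair of matrices whose entries are independent variables. -/
noncomputable def genericPair (V : Type*) : MatrixPair V (MvPolynomial (Coord V) ℝ) :=
  (Matrix.of fun v w => MvPolynomial.X (Sum.inl (v, w)),
    Matrix.of fun v w => MvPolynomial.X (Sum.inr (v, w)))

theorem map_genericPair_fst (θ : MatrixPair V ℝ) :
    (genericPair V).1.map (MvPolynomial.eval (pairEntries θ)) = θ.1 := by
  ext v w
  simp [genericPair, pairEntries, entries]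

theorem map_genericPair_snd (θ : MatrixPair V ℝ) :
    (genericPair V).2.map (MvPolynomial.eval (pairEntries θ)) = θ.2 := by
  ext v w
  simp [genericPair, pairEntries, entries]

theorem HalfTrekLinking.eventually_det_ne_zero [Fintype V] [DecidableEq V] {P : Set V}
    {src : P → V} (h : G.HalfTrekLinking P src) :
    ∀ᶠ θ in G.generic, (linkMatrix src θ.1 θ.2).det ≠ 0 := by
  have heval (θ : MatrixPair V ℝ) : MvPolynomial.eval (pairEntries θ)
      (linkMatrix src (genericPair V).1 (genericPair V).2).det = (linkMatrix src θ.1 θ.2).det := by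
    rw [mvPolynomial_eval_det, map_linkMatrix, map_genericPair_fst, map_genericPair_snd]
  obtain ⟨η, hη, hdet⟩ := exists_mem_support_det_linkMatrix_ne_zero h
  exact (eventually_eval_ne_zero (projectHom_ne_zero_of_mem_support hη (by rwa [heval]))).mono
    fun θ hθ => by rwa [heval] at hθ

end Linking

end MixedGraph

namespace MixedGraph

section RationalFunctions

variable {V : Type*} [Fintype V] [DecidableEq V] {G : MixedGraph V}

variable (G) in
/-- The algebra of functions of the parameters that are, generically, rational functions of the
covariance matrix. -/
def rationalFunctions : Subalgebra ℝ (MatrixPair V ℝ → ℝ) where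
  carrier := {g | ∃ n d : MvPolynomial (V × V) ℝ, ∀ᶠ θ in G.generic,
    MvPolynomial.eval (entries (phi θ)) d ≠ 0 ∧
    g θ = MvPolynomial.eval (entries (phi θ)) n / MvPolynomial.eval (entries (phi θ)) d}
  mul_mem' := by
    rintro f g ⟨n, d, h⟩ ⟨n', d', h'⟩
    refine ⟨n * n', d * d', ?_⟩
    filter_upwards [h, h'] with θ ⟨hd, hf⟩ ⟨hd', hg⟩
    exact ⟨by simp [hd, hd'], by rw [Pi.mul_apply, map_mul, map_mul, hf, hg, div_mul_div_comm]⟩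
  add_mem' := by
    rintro f g ⟨n, d, h⟩ ⟨n', d', h'⟩
    refine ⟨n * d' + d * n', d * d', ?_⟩
    filter_upwards [h, h'] with θ ⟨hd, hf⟩ ⟨hd', hg⟩
    refine ⟨by simp [hd, hd'], ?_⟩
    simp only [Pi.add_apply, map_mul, map_add, hf, hg, div_add_div _ _ hd hd']
  algebraMap_mem' c := ⟨MvPolynomial.C c, 1, by simp⟩

theorem rationalFunctions_congr {f g : MatrixPair V ℝ → ℝ} (hf : f ∈ G.rationalFunctions)
    (h : ∀ᶠ θ in G.generic, g θ = f θ) : g ∈ G.rationalFunctions := by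
  obtain ⟨n, d, h'⟩ := hf
  exact ⟨n, d, by filter_upwards [h, h'] with θ h h' using ⟨h'.1, h.trans h'.2⟩⟩

theorem inv_mem_rationalFunctions {f : MatrixPair V ℝ → ℝ} (hf : f ∈ G.rationalFunctions)
    (h : ∀ᶠ θ in G.generic, f θ ≠ 0) : (fun θ => (f θ)⁻¹) ∈ G.rationalFunctions := by
  obtain ⟨n, d, h'⟩ := hf
  refine ⟨d, n, ?_⟩
  filter_upwards [h, h'] with θ h h'
  rw [h'.2] at h ⊢
  exact ⟨(div_ne_zero_iff.mp h).1, inv_div _ _⟩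

theorem phi_mem_rationalFunctions (v w : V) : (fun θ => phi θ v w) ∈ G.rationalFunctions :=
  ⟨MvPolynomial.X (v, w), 1, by simp [entries]⟩

theorem const_mem_rationalFunctions (c : ℝ) : (fun _ => c) ∈ G.rationalFunctions :=
  G.rationalFunctions.algebraMap_mem c

theorem one_sub_apply_mem_rationalFunctions {v w : V}
    (h : (fun θ => θ.1 v w) ∈ G.rationalFunctions) :
    (fun θ => (1 - θ.1) v w) ∈ G.rationalFunctions :=
  G.rationalFunctions.sub_mem (const_mem_rationalFunctions _) h

theorem mul_apply_mem_rationalFunctions {l m n : Type*} [Fintype m]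
    {M : MatrixPair V ℝ → Matrix l m ℝ} {N : MatrixPair V ℝ → Matrix m n ℝ} {i : l} {j : n}
    (hM : ∀ k, (fun θ => M θ i k) ∈ G.rationalFunctions)
    (hN : ∀ k, (fun θ => N θ k j) ∈ G.rationalFunctions) :
    (fun θ => (M θ * N θ) i j) ∈ G.rationalFunctions := by
  convert G.rationalFunctions.sum_mem fun k (_ : k ∈ Finset.univ) =>
    G.rationalFunctions.mul_mem (hM k) (hN k) using 1
  funext θ
  simp only [Matrix.mul_apply, Finset.sum_apply, Pi.mul_apply]

theorem mulVec_apply_mem_rationalFunctions {l m : Type*} [Fintype m]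
    {M : MatrixPair V ℝ → Matrix l m ℝ} {b : MatrixPair V ℝ → m → ℝ} {i : l}
    (hM : ∀ k, (fun θ => M θ i k) ∈ G.rationalFunctions)
    (hb : ∀ k, (fun θ => b θ k) ∈ G.rationalFunctions) :
    (fun θ => (M θ *ᵥ b θ) i) ∈ G.rationalFunctions :=
  mul_apply_mem_rationalFunctions (N := fun θ => Matrix.replicateCol Unit (b θ)) (j := ()) hM hb

theorem det_mem_rationalFunctions {ι : Type*} [Fintype ι] [DecidableEq ι]
    {M : MatrixPair V ℝ → Matrix ι ι ℝ} (hM : ∀ i j, (fun θ => M θ i j) ∈ G.rationalFunctions) :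
    (fun θ => (M θ).det) ∈ G.rationalFunctions := by
  convert G.rationalFunctions.sum_mem fun (σ : Equiv.Perm ι) (_ : σ ∈ Finset.univ) =>
    G.rationalFunctions.smul_mem (G.rationalFunctions.prod_mem fun i (_ : i ∈ Finset.univ) =>
      hM (σ i) i) ((σ.sign : ℤ) : ℝ) using 1
  funext θ
  simp [Matrix.det_apply', Finset.sum_apply, Finset.prod_apply]

theorem mem_rationalFunctions_of_mulVec_eq_of_det_ne_zero {n : Type*} [Fintype n] [DecidableEq n]
    {A : MatrixPair V ℝ → Matrix n n ℝ} {b x : MatrixPair V ℝ → n → ℝ}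
    (hA : ∀ i j, (fun θ => A θ i j) ∈ G.rationalFunctions)
    (hb : ∀ i, (fun θ => b θ i) ∈ G.rationalFunctions)
    (hx : ∀ᶠ θ in G.generic, A θ *ᵥ x θ = b θ) (hdet : ∀ᶠ θ in G.generic, (A θ).det ≠ 0) (j : n) :
    (fun θ => x θ j) ∈ G.rationalFunctions := by
  have hcol : ∀ i k, (fun θ => (A θ).updateCol j (b θ) i k) ∈ G.rationalFunctions := by
    intro i k
    obtain rfl | hk := eq_or_ne k j
    · simpa only [Matrix.updateCol_self] using hb i
    · simpa only [Matrix.updateCol_ne hk] using hA i k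
  refine rationalFunctions_congr (G.rationalFunctions.mul_mem
    (inv_mem_rationalFunctions (det_mem_rationalFunctions hA) hdet)
    (det_mem_rationalFunctions hcol)) ?_
  filter_upwards [hx, hdet] with θ hx hdet
  have hcramer : (A θ).cramer (b θ) = (A θ).det • x θ := by
    rw [← hx, Matrix.cramer_eq_adjugate_mulVec, Matrix.mulVec_mulVec, Matrix.adjugate_mul,
      Matrix.smul_mulVec, Matrix.one_mulVec]
  rw [Pi.mul_apply, eq_inv_mul_iff_mul_eq₀ hdet, ← Matrix.cramer_apply, hcramer, Pi.smul_apply,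
    smul_eq_mul]

theorem mem_rationalFunctions_of_mulVec_eq {m n : Type*} [Finite m] [Fintype n]
    {A : MatrixPair V ℝ → Matrix m n ℝ} {b : MatrixPair V ℝ → m → ℝ} {x : MatrixPair V ℝ → n → ℝ}
    (hA : ∀ i j, (fun θ => A θ i j) ∈ G.rationalFunctions)
    (hb : ∀ i, (fun θ => b θ i) ∈ G.rationalFunctions)
    (hx : ∀ᶠ θ in G.generic, A θ *ᵥ x θ = b θ)
    (hinj : ∀ᶠ θ in G.generic, ∀ c, A θ *ᵥ c = 0 → c = 0) (j : n) :
    (fun θ => x θ j) ∈ G.rationalFunctions := by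
  classical
  have := Fintype.ofFinite m
  refine mem_rationalFunctions_of_mulVec_eq_of_det_ne_zero (A := fun θ => (A θ)ᵀ * A θ)
    (b := fun θ => (A θ)ᵀ *ᵥ b θ)
    (fun i k => mul_apply_mem_rationalFunctions (fun l => hA l i) fun l => hA l k)
    (fun i => mulVec_apply_mem_rationalFunctions (fun l => hA l i) hb)
    (hx.mono fun θ hx => by rw [← hx, Matrix.mulVec_mulVec]) (hinj.mono fun θ hinj hdet => ?_) j
  obtain ⟨c, hc, hAc⟩ := Matrix.exists_mulVec_eq_zero_iff.mpr hdet
  have hker : c ∈ LinearMap.ker ((A θ)ᵀ * A θ).mulVecLin := hAc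
  rw [Matrix.ker_mulVecLin_transpose_mul_self] at hker
  exact hc (hinj c hker)

end RationalFunctions

section Covariance

variable {V : Type*} [Fintype V] [DecidableEq V] {G : MixedGraph V} {θ : MatrixPair V ℝ}

theorem one_sub_transpose_mul_phi (h : IsUnit (1 - θ.1)) :
    (1 - θ.1)ᵀ * phi θ = θ.2 * (1 - θ.1)⁻¹ := by
  have hdet := (Matrix.isUnit_iff_isUnit_det _).mp h
  rw [phi, ← mul_assoc, ← mul_assoc, ← Matrix.transpose_mul, Matrix.nonsing_inv_mul _ hdet,
    Matrix.transpose_one, one_mul]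

theorem phi_mul_one_sub (h : IsUnit (1 - θ.1)) : phi θ * (1 - θ.1) = ((1 - θ.1)⁻¹)ᵀ * θ.2 := by
  rw [phi, mul_assoc, Matrix.nonsing_inv_mul _ ((Matrix.isUnit_iff_isUnit_det _).mp h), mul_one]

theorem one_sub_transpose_mul_phi_mul (h : IsUnit (1 - θ.1)) :
    (1 - θ.1)ᵀ * phi θ * (1 - θ.1) = θ.2 := by
  rw [one_sub_transpose_mul_phi h, mul_assoc,
    Matrix.nonsing_inv_mul _ ((Matrix.isUnit_iff_isUnit_det _).mp h), mul_one]

variable {v : V}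

theorem one_sub_apply_eq_zero (hθ : θ ∈ G.Theta) {u w : V} (hu : G.Reach v u)
    (hw : ¬ G.Reach v w) : (1 - θ.1) u w = 0 := by
  have hne : u ≠ w := fun h => hw (h ▸ hu)
  simp [hne, hθ.1.1 u w fun h => hw (hu.trans_edge h)]

theorem one_sub_inv_apply_eq_zero (hθ : θ ∈ G.Theta) {u w : V} (hu : G.Reach v u)
    (hw : ¬ G.Reach v w) : (1 - θ.1)⁻¹ u w = 0 := by
  -- `1 - Λ` is block triangular for the partition into reachable and unreachable nodes.
  have htriangular : (1 - θ.1).BlockTriangular (G.Reach v) := fun i j hij =>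
    one_sub_apply_eq_zero hθ (Classical.not_imp.mp hij.2).1 (Classical.not_imp.mp hij.2).2
  have := hθ.1.2.invertible
  exact Matrix.blockTriangular_inv_of_blockTriangular htriangular
    ⟨fun h => absurd h hw, fun h => hw (h hu)⟩

theorem phi_mul_one_sub_apply_eq_zero (hθ : θ ∈ G.Theta) {w : V} (hw : ¬ G.Reach v w) :
    (phi θ * (1 - θ.1)) w v = 0 := by
  rw [phi_mul_one_sub hθ.1.2, Matrix.mul_apply]
  refine Finset.sum_eq_zero fun u _ => ?_
  by_cases hu : G.Reach v u
  · rw [Matrix.transpose_apply, one_sub_inv_apply_eq_zero hθ hu hw, zero_mul]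
  · rw [apply_eq_zero_of_not_linked hθ fun h => hu h.symm.reach, mul_zero]

end Covariance

section Identification

variable {V : Type*} [Fintype V] [DecidableEq V] {G : MixedGraph V} {v : V} {src : G.pa v → V}

open Classical in
variable (G) in
/-- The coefficient matrix of the linear equations that determine the column `v` of `Λ`. The rows
of nodes that are not half-trek reachable from `v` come from the covariance matrix `φ θ`, those of
the reachable sources from `(I - Λ)ᵀ φ θ`, which has known entries there if the columns of `Λ` at
these sources are known. -/
noncomputable def identMatrix (v : V) (src : G.pa v → V) (θ : MatrixPair V ℝ) : Matrix V V ℝ :=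
  Matrix.of fun w => if ¬ G.Reach v w then phi θ w else
    if w ∈ Set.range src then ((1 - θ.1)ᵀ * phi θ : Matrix V V ℝ) w else 0

theorem identMatrix_of_not_reach (θ : MatrixPair V ℝ) {w : V} (hw : ¬ G.Reach v w) :
    G.identMatrix v src θ w = phi θ w :=
  if_pos hw

theorem identMatrix_of_reach (θ : MatrixPair V ℝ) {p : G.pa v} (hp : G.Reach v (src p)) :
    G.identMatrix v src θ (src p) = ((1 - θ.1)ᵀ * phi θ : Matrix V V ℝ) (src p) :=
  (if_neg (not_not.mpr hp)).trans (if_pos (Set.mem_range_self p))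

theorem identMatrix_of_notMem_range (θ : MatrixPair V ℝ) {w : V} (hw : G.Reach v w)
    (hsrc : w ∉ Set.range src) : G.identMatrix v src θ w = 0 :=
  (if_neg (not_not.mpr hw)).trans (if_neg hsrc)

theorem identMatrix_apply_mem_rationalFunctions
    (h : ∀ p, G.Reach v (src p) → ∀ u, (fun θ => θ.1 u (src p)) ∈ G.rationalFunctions) (w u : V) :
    (fun θ => G.identMatrix v src θ w u) ∈ G.rationalFunctions := by
  by_cases hr : G.Reach v w
  · by_cases hw : w ∈ Set.range src
    · obtain ⟨p, rfl⟩ := hw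
      simp only [identMatrix_of_reach _ hr]
      exact mul_apply_mem_rationalFunctions (M := fun θ => (1 - θ.1)ᵀ)
        (fun k => one_sub_apply_mem_rationalFunctions (h p hr k))
        fun k => phi_mem_rationalFunctions k u
    · simp only [identMatrix_of_notMem_range _ hr hw]
      exact const_mem_rationalFunctions 0
  · simp only [identMatrix_of_not_reach _ hr]
    exact phi_mem_rationalFunctions w u

theorem identMatrix_mul_one_sub_apply_eq_zero {θ : MatrixPair V ℝ} (hθ : θ ∈ G.Theta)
    (hsrc : ∀ p, ¬ G.Linked (src p) v) (w : V) :
    (G.identMatrix v src θ * (1 - θ.1)) w v = 0 := by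
  by_cases hr : G.Reach v w
  · by_cases hw : w ∈ Set.range src
    · obtain ⟨p, rfl⟩ := hw
      rw [Matrix.mul_apply_eq_vecMul, identMatrix_of_reach _ hr,
        ← Matrix.mul_apply_eq_vecMul ((1 - θ.1)ᵀ * phi θ),
        one_sub_transpose_mul_phi_mul hθ.1.2, apply_eq_zero_of_not_linked hθ (hsrc p)]
    · rw [Matrix.mul_apply_eq_vecMul, identMatrix_of_notMem_range _ hr hw, Matrix.zero_vecMul,
        Pi.zero_apply]
  · rw [Matrix.mul_apply_eq_vecMul, identMatrix_of_not_reach _ hr,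
      ← Matrix.mul_apply_eq_vecMul (phi θ), phi_mul_one_sub_apply_eq_zero hθ hr]

theorem eq_zero_of_identMatrix_mulVec_eq_zero {θ : MatrixPair V ℝ} (hθ : θ ∈ G.Theta)
    (hdet : (linkMatrix src θ.1 θ.2).det ≠ 0) {c : V → ℝ} (hc : ∀ w ∉ G.pa v, c w = 0)
    (h : G.identMatrix v src θ *ᵥ c = 0) : c = 0 := by
  have hphi : ∀ w, ¬ G.Reach v w → (phi θ *ᵥ c) w = 0 := fun w hw => by
    have hrow := congrFun h w
    rwa [Matrix.mulVec, identMatrix_of_not_reach θ hw] at hrow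
  have hsrc : ∀ p, (((1 - θ.1)ᵀ * phi θ) *ᵥ c) (src p) = 0 := fun p => by
    by_cases hr : G.Reach v (src p)
    · have hrow := congrFun h (src p)
      rwa [Matrix.mulVec, identMatrix_of_reach θ hr] at hrow
    rw [← Matrix.mulVec_mulVec]
    refine Finset.sum_eq_zero fun k _ => ?_
    change (1 - θ.1) k (src p) * (phi θ *ᵥ c) k = 0
    by_cases hk : G.Reach v k
    · rw [one_sub_apply_eq_zero hθ hk hr, zero_mul]
    · rw [hphi k hk, mul_zero]
  have hunit := (Matrix.isUnit_iff_isUnit_det _).mp hθ.1.2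
  have hlink : linkMatrix src θ.1 θ.2 *ᵥ ((1 - θ.1)⁻¹ *ᵥ c) = 0 := by
    funext w
    by_cases hw : w ∈ G.pa v
    · rw [linkMatrix_mulVec_of_mem src _ _ _ ⟨w, hw⟩, Matrix.mulVec_mulVec,
        ← one_sub_transpose_mul_phi hθ.1.2, hsrc, Pi.zero_apply]
    · rw [linkMatrix_mulVec_of_notMem src _ _ _ hw, Matrix.mulVec_mulVec,
        Matrix.mul_nonsing_inv _ hunit, Matrix.one_mulVec, hc w hw, Pi.zero_apply]
  have hinv := Matrix.eq_zero_of_mulVec_eq_zero hdet hlink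
  rw [← Matrix.one_mulVec c, ← Matrix.mul_nonsing_inv _ hunit, ← Matrix.mulVec_mulVec, hinv,
    Matrix.mulVec_zero]

theorem HalfTrekCriterion.mem_rationalFunctions {Y : Set V} (h : G.HalfTrekCriterion Y v)
    (hY : ∀ w ∈ Y ∩ G.htr v, ∀ u, (fun θ => θ.1 u w) ∈ G.rationalFunctions) (u : V) :
    (fun θ => θ.1 u v) ∈ G.rationalFunctions := by
  classical
  obtain ⟨hnot, src, rfl, hlink⟩ := halfTrekCriterion_iff.mp h
  have hsrc (p) : ¬ G.Linked (src p) v := hnot _ ⟨p, rfl⟩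
  have hrat := identMatrix_apply_mem_rationalFunctions fun p hr =>
    hY _ ⟨⟨p, rfl⟩, mem_htr_iff.mpr ⟨hsrc p, hr⟩⟩
  -- The second block of rows says that the entries outside `pa v` vanish.
  let A (θ : MatrixPair V ℝ) : Matrix (V ⊕ V) V ℝ := Matrix.fromRows (G.identMatrix v src θ)
    (Matrix.diagonal fun w => if w ∈ G.pa v then 0 else 1)
  refine mem_rationalFunctions_of_mulVec_eq (A := A)
    (b := fun θ => Sum.elim (fun w => G.identMatrix v src θ w v) 0) (x := fun θ u => θ.1 u v)
    ?_ ?_ ?_ ?_ u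
  · exact Sum.rec hrat fun _ _ => const_mem_rationalFunctions _
  · exact Sum.rec (fun w => hrat w v) fun _ => const_mem_rationalFunctions 0
  · filter_upwards [eventually_mem_Theta] with θ hθ
    rw [Matrix.fromRows_mulVec]
    congr 1 <;> funext w
    · have hcol := identMatrix_mul_one_sub_apply_eq_zero hθ hsrc w
      rw [mul_sub, mul_one, Matrix.sub_apply, sub_eq_zero] at hcol
      exact hcol.symm
    · by_cases hw : w ∈ G.pa v
      · simp [Matrix.mulVec_diagonal, hw]
      · simp [Matrix.mulVec_diagonal, hθ.1.1 w v hw]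
  · filter_upwards [eventually_mem_Theta, hlink.eventually_det_ne_zero] with θ hθ hdet c hc
    rw [Matrix.fromRows_mulVec, ← Sum.elim_zero_zero, Sum.elim_eq_iff] at hc
    refine eq_zero_of_identMatrix_mulVec_eq_zero hθ hdet (fun w hw => ?_) hc.1
    simpa [Matrix.mulVec_diagonal, hw] using congrFun hc.2 w

theorem HTCIdentifiable.pairEntries_mem_rationalFunctions (h : G.HTCIdentifiable) (i : Coord V) :
    (fun θ => pairEntries θ i) ∈ G.rationalFunctions := by
  obtain ⟨Y, hY, r, hr, hord⟩ := h
  have hwf : WellFounded r := Finite.wellFounded_of_trans_of_irrefl r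
  have hΛ : ∀ w v, (fun θ => θ.1 v w) ∈ G.rationalFunctions := fun w =>
    hwf.induction w fun w ih => (hY w).mem_rationalFunctions fun u hu => ih u (hord w u hu)
  rcases i with ⟨v, w⟩ | ⟨v, w⟩
  · exact hΛ w v
  · have h1ΛT (l) : (fun θ => (1 - θ.1)ᵀ v l) ∈ G.rationalFunctions :=
      one_sub_apply_mem_rationalFunctions (hΛ v l)
    refine rationalFunctions_congr (mul_apply_mem_rationalFunctions (fun k =>
      mul_apply_mem_rationalFunctions h1ΛT fun l => phi_mem_rationalFunctions l k) fun k =>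
      one_sub_apply_mem_rationalFunctions (hΛ w k)) ?_
    filter_upwards [eventually_mem_Theta] with θ hθ
    rw [one_sub_transpose_mul_phi_mul hθ.1.2]
    rfl

theorem HTCIdentifiable.rationallyIdentifiable (h : G.HTCIdentifiable) :
    G.RationallyIdentifiable := by
  choose n d hnd using h.pairEntries_mem_rationalFunctions
  obtain ⟨A, hA, hA'⟩ := exists_isProperAlgebraicSubset (eventually_all.mpr hnd)
  refine ⟨A, hA, ⟨n, d, fun i hzero => ?_⟩, fun θ hθ => ⟨fun i => (hA' θ hθ i).1,
    funext fun i => (hA' θ hθ i).2.symm⟩⟩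
  obtain ⟨θ, hθ, -⟩ := (hnd i).exists
  exact hθ (by rw [hzero, map_zero])

end Identification

end MixedGraph

section Minors

theorem exists_det_submatrix_ne_zero_of_linearIndependent_col {K m n : Type*} [Field K]
    [Finite m] [Fintype n] [DecidableEq n] {J : Matrix m n K} (hJ : LinearIndependent K J.col) :
    ∃ r : n → m, (J.submatrix r id).det ≠ 0 := by
  have := Fintype.ofFinite m
  have hrank : J.rank = Fintype.card n := by
    rw [← Matrix.rank_transpose]
    exact hJ.rank_matrix (M := Jᵀ)
  obtain ⟨κ, a, ha, hspan, hli⟩ := exists_linearIndependent' K J.row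
  have := Fintype.ofInjective a ha
  have hcard : Fintype.card n = Fintype.card κ := by
    rw [linearIndependent_iff_card_eq_finrank_span.mp hli, Set.finrank, hspan,
      ← Matrix.rank_eq_finrank_span_row, hrank]
  obtain ⟨e⟩ := Fintype.card_eq.mp hcard
  refine ⟨a ∘ e, IsUnit.ne_zero ?_⟩
  rw [← Matrix.isUnit_iff_isUnit_det, ← Matrix.linearIndependent_rows_iff_isUnit]
  exact hli.comp e e.injective

theorem exists_det_submatrix_ne_zero {R m n : Type*} [CommRing R] [IsDomain R] [Finite m]
    [Fintype n] [DecidableEq n] {J : Matrix m n R} (hJ : ∀ k, J *ᵥ k = 0 → k = 0) :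
    ∃ r : n → m, (J.submatrix r id).det ≠ 0 := by
  let φ := algebraMap R (FractionRing R)
  have hinj : Function.Injective φ := IsFractionRing.injective R (FractionRing R)
  have hli : LinearIndependent R (J.map φ).col := by
    refine LinearIndependent.map' (v := J.col) ?_
      ((Algebra.linearMap R (FractionRing R)).compLeft m) (LinearMap.ker_eq_bot.mpr hinj.comp_left)
    exact Matrix.mulVec_injective_iff.mp ((injective_iff_map_eq_zero J.mulVecLin).mpr hJ)
  obtain ⟨r, hr⟩ := exists_det_submatrix_ne_zero_of_linearIndependent_col
    ((LinearIndependent.iff_fractionRing R (FractionRing R)).mp hli)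
  refine ⟨r, fun h => hr ?_⟩
  rw [Matrix.submatrix_map, ← RingHom.mapMatrix_apply, ← RingHom.map_det, h, map_zero]

/-- The matrix obtained from `A` by clearing the entries whose row and column have different
values under `f`. -/
def blockPart {R ι γ : Type*} [Zero R] [DecidableEq γ] (f : ι → γ) (A : Matrix ι ι R) :
    Matrix ι ι R :=
  Matrix.of fun i j => if f i = f j then A i j else 0

theorem det_toSquareBlock_ne_zero_of_blockPart {R ι γ : Type*} [CommRing R] [Fintype ι]
    [DecidableEq ι] [DecidableEq γ] {f : ι → γ} {A : Matrix ι ι R} (h : (blockPart f A).det ≠ 0)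
    (c : γ) : (A.toSquareBlock f c).det ≠ 0 := by
  rw [(blockPart f A).twoBlockTriangular_det (f · = c) fun i hi j hj => if_neg (hj ▸ hi)] at h
  convert left_ne_zero_of_mul h using 2
  ext ⟨i, hi⟩ ⟨j, hj⟩
  exact (if_pos (hi.trans hj.symm)).symm

-- Each permutation of the rows arises from as many pairs of a permutation `σ` and a permutation in
-- the expansion of the block part as there are permutations that preserve the blocks.
theorem sum_sign_mul_det_blockPart {R ι γ : Type*} [CommRing R] [Fintype ι] [DecidableEq ι]
    [DecidableEq γ] (f : ι → γ) (A : Matrix ι ι R) :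
    ∑ σ : Equiv.Perm ι, ((σ.sign : ℤ) : R) * (blockPart f (A.submatrix σ id)).det =
      Finset.card {τ : Equiv.Perm ι | ∀ i, f (τ i) = f i} * A.det := by
  have hprod (σ τ : Equiv.Perm ι) : ∏ i, blockPart f (A.submatrix σ id) (τ i) i =
      if ∀ i, f (τ i) = f i then ∏ i, A ((σ * τ : Equiv.Perm ι) i) i else 0 := by
    simp only [blockPart, Matrix.of_apply, Matrix.submatrix_apply, id, Fintype.prod_ite_zero,
      Equiv.Perm.mul_apply]
  calc _ = ∑ σ : Equiv.Perm ι, ∑ τ : Equiv.Perm ι with ∀ i, f (τ i) = f i,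
        (((σ * τ).sign : ℤ) : R) * ∏ i, A ((σ * τ : Equiv.Perm ι) i) i := by
        simp [Matrix.det_apply', hprod, Finset.mul_sum, Finset.sum_filter, mul_assoc]
    _ = ∑ τ : Equiv.Perm ι with ∀ i, f (τ i) = f i, A.det := by
        rw [Finset.sum_comm]
        refine Finset.sum_congr rfl fun τ _ => ?_
        rw [Matrix.det_apply']
        exact Fintype.sum_equiv (Equiv.mulRight τ) _ _ fun σ => rfl
    _ = _ := by rw [Finset.sum_const, nsmul_eq_mul]

theorem exists_perm_forall_det_toSquareBlock_ne_zero {R ι γ : Type*} [CommRing R] [IsDomain R]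
    [CharZero R] [Fintype ι] [DecidableEq ι] [DecidableEq γ] (f : ι → γ) {A : Matrix ι ι R}
    (hA : A.det ≠ 0) :
    ∃ σ : Equiv.Perm ι, ∀ c, ((A.submatrix σ id).toSquareBlock f c).det ≠ 0 := by
  have hcard : Finset.card {τ : Equiv.Perm ι | ∀ i, f (τ i) = f i} ≠ 0 :=
    Finset.card_ne_zero_of_mem (a := 1) (by simp)
  have hsum := mul_ne_zero (Nat.cast_ne_zero.mpr hcard) hA
  rw [← sum_sign_mul_det_blockPart] at hsum
  obtain ⟨σ, -, hσ⟩ := Finset.exists_ne_zero_of_sum_ne_zero hsum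
  exact ⟨σ, det_toSquareBlock_ne_zero_of_blockPart (right_ne_zero_of_mul hσ)⟩

theorem exists_perm_forall_ne_zero {R ι : Type*} [CommRing R] [Fintype ι] [DecidableEq ι]
    {A : Matrix ι ι R} (hA : A.det ≠ 0) : ∃ τ : Equiv.Perm ι, ∀ i, A i (τ i) ≠ 0 := by
  rw [← Matrix.det_transpose, Matrix.det_apply'] at hA
  obtain ⟨τ, -, hτ⟩ := Finset.exists_ne_zero_of_sum_ne_zero hA
  exact ⟨τ, fun i hi => hτ (by rw [Finset.prod_eq_zero (Finset.mem_univ i) hi, mul_zero])⟩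

end Minors

section FirstReturn

variable {α : Type*} {P : Set α} {τ : Equiv.Perm α}

theorem exists_iterate_firstReturn [Finite α] (τ : Equiv.Perm α) (P : Set α) :
    ∃ N : P → ℕ, (∀ p : P, τ^[N p] (τ p) ∈ P) ∧ ∀ p : P, ∀ j < N p, τ^[j] (τ p) ∉ P := by
  classical
  have hreturn (p : P) : ∃ k, τ^[k] (τ p) ∈ P := by
    refine ⟨orderOf τ - 1, ?_⟩
    rw [← Function.iterate_succ_apply, Nat.succ_eq_add_one, Nat.sub_add_cancel (orderOf_pos τ),
      ← Equiv.Perm.coe_pow, pow_orderOf_eq_one]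
    exact p.2
  exact ⟨fun p => Nat.find (hreturn p), fun p => Nat.find_spec (hreturn p),
    fun p j hj => Nat.find_min (hreturn p) hj⟩

theorem eq_of_iterate_eq_of_firstReturn {N : P → ℕ}
    (hN : ∀ p : P, ∀ j < N p, τ^[j] (τ p) ∉ P) {p q : P} {i j : ℕ} (hi : i ≤ N p) (hj : j ≤ N q)
    (h : τ^[i] (τ p) = τ^[j] (τ q)) : p = q := by
  wlog hij : i ≤ j generalizing p q i j
  · exact (this hj hi h.symm (le_of_not_ge hij)).symm
  obtain ⟨k, rfl⟩ := Nat.exists_eq_add_of_le hij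
  rw [Function.iterate_add_apply] at h
  have hp : τ p = τ^[k] (τ q) := τ.injective.iterate i h
  rcases k with - | k
  · exact Subtype.ext (τ.injective hp)
  · rw [Function.iterate_succ_apply'] at hp
    exact absurd (τ.injective hp ▸ p.2) (hN q k (by omega))

end FirstReturn

namespace MixedGraph

section LinkingOfDet

variable {V : Type*} {G : MixedGraph V}

theorem exists_diPath_iterate {P : Set V} {τ : V → V} (hτ : ∀ w ∉ P, τ w = w ∨ G.D w (τ w))
    {k : ℕ} {x : V} (hx : ∀ j < k, τ^[j] x ∉ P) :
    ∃ p : G.DiPath x (τ^[k] x), ∀ y ∈ p.nodes, ∃ j ≤ k, τ^[j] x = y := by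
  induction k generalizing x with
  | zero => exact ⟨.nil x, fun y hy => ⟨0, le_rfl, hy.symm⟩⟩
  | succ k ih =>
    rcases hτ x (hx 0 (by omega)) with h | h
    · obtain ⟨p, hp⟩ := ih fun j hj => hx j (by omega)
      rw [Function.iterate_succ_apply, h]
      exact ⟨p, fun y hy => (hp y hy).imp fun _ hj => ⟨by omega, hj.2⟩⟩
    · obtain ⟨p, hp⟩ := ih (x := τ x) fun j hj => hx (j + 1) (by omega)
      refine ⟨.cons h p, ?_⟩
      rintro y (rfl | hy)
      · exact ⟨0, by omega, rfl⟩
      · obtain ⟨j, hj, rfl⟩ := hp y hy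
        exact ⟨j + 1, by omega, rfl⟩

/-- The half-treks follow the cycles of `τ` from one element of `P` to the next. -/
theorem exists_halfTrekLinking_of_perm [Finite V] {P : Set V} {src : P → V}
    (hsrc : Function.Injective src) (τ : Equiv.Perm V) (hP : ∀ p : P, G.Linked (src p) (τ p))
    (hτ : ∀ w ∉ P, τ w = w ∨ G.D w (τ w)) :
    ∃ src' : P → V, Set.range src' = Set.range src ∧ G.HalfTrekLinking P src' := by
  obtain ⟨N, hNP, hN⟩ := exists_iterate_firstReturn τ P
  let next (p : P) : P := ⟨τ^[N p] (τ p), hNP p⟩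
  have hnext : Function.Injective next := fun p q h =>
    eq_of_iterate_eq_of_firstReturn hN le_rfl le_rfl (congrArg Subtype.val h)
  let e : P ≃ P := Equiv.ofBijective next (Finite.injective_iff_bijective.mp hnext)
  have hpath (p' : P) : ∃ p : G.DiPath (τ (e.symm p')) p',
      ∀ y ∈ p.nodes, ∃ j ≤ N (e.symm p'), τ^[j] (τ (e.symm p')) = y := by
    obtain ⟨q, rfl⟩ := e.surjective p'
    rw [Equiv.symm_apply_apply]
    exact exists_diPath_iterate hτ (hN q)
  choose path hnodes using hpath
  refine ⟨src ∘ e.symm, e.symm.surjective.range_comp src, hsrc.comp e.symm.injective,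
    fun p => τ (e.symm p), path, fun p => hP _, fun p q hpq => ?_⟩
  refine Set.disjoint_left.mpr fun y hyp hyq => hpq (e.symm.injective ?_)
  obtain ⟨i, hi, rfl⟩ := hnodes p y hyp
  obtain ⟨j, hj, h⟩ := hnodes q _ hyq
  exact eq_of_iterate_eq_of_firstReturn hN hi hj h.symm

variable [Fintype V] [DecidableEq V] {R : Type*} [CommRing R]

theorem exists_halfTrekLinking_of_det_ne_zero {P : Set V} {src : P → V}
    (hsrc : Function.Injective src) {θ : MatrixPair V R} (hθ : θ ∈ G.support)
    (h : (linkMatrix src θ.1 θ.2).det ≠ 0) :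
    ∃ src' : P → V, Set.range src' = Set.range src ∧ G.HalfTrekLinking P src' := by
  obtain ⟨hΛ, -, hΩ⟩ := hθ
  obtain ⟨τ, hτ⟩ := exists_perm_forall_ne_zero h
  refine exists_halfTrekLinking_of_perm hsrc τ (fun p => ?_) fun w hw => ?_
  · have hp := hτ p
    rw [linkMatrix_of_mem] at hp
    by_contra hlinked
    exact hp (hΩ _ _ hlinked)
  · have hentry := hτ w
    rw [linkMatrix_of_notMem src θ.1 θ.2 hw] at hentry
    by_contra! hcon
    exact hentry (by simp [hcon.1.symm, hΛ _ _ hcon.2])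

theorem det_linkMatrix_ne_zero [IsDomain R] {P : Set V} [Fintype P] {src : P → V}
    {Λ Ω : Matrix V V R} (hΛ : (1 - Λ).det ≠ 0)
    (h : ((Ω * (1 - Λ).adjugate).submatrix src Subtype.val : Matrix P P R).det ≠ 0) :
    (linkMatrix src Λ Ω).det ≠ 0 := by
  classical
  have hmem (p : P) (w : V) : (linkMatrix src Λ Ω * (1 - Λ).adjugate) p w =
      (Ω * (1 - Λ).adjugate) (src p) w := by
    rw [Matrix.mul_apply_eq_vecMul, linkMatrix_of_mem, ← Matrix.mul_apply_eq_vecMul Ω]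
  have hnotMem {u : V} (hu : u ∉ P) (w : V) : (linkMatrix src Λ Ω * (1 - Λ).adjugate) u w =
      ((1 - Λ).det • (1 : Matrix V V R)) u w := by
    rw [Matrix.mul_apply_eq_vecMul, linkMatrix_of_notMem src Λ Ω hu,
      ← Matrix.mul_apply_eq_vecMul (1 - Λ), Matrix.mul_adjugate]
  refine left_ne_zero_of_mul (b := (1 - Λ).adjugate.det) ?_
  rw [← Matrix.det_mul, Matrix.twoBlockTriangular_det _ (· ∈ P) fun u hu w hw => by
    rw [hnotMem hu, Matrix.smul_apply, Matrix.one_apply_ne (ne_of_mem_of_not_mem hw hu).symm,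
      smul_zero]]
  refine mul_ne_zero ?_ ?_
  · convert h using 2
    ext p q
    exact hmem p q
  · have hscalar : (linkMatrix src Λ Ω * (1 - Λ).adjugate).toSquareBlockProp (· ∉ P) =
        (1 - Λ).det • 1 := by
      ext u w
      rw [Matrix.toSquareBlockProp_def, Matrix.of_apply, hnotMem u.2]
      simp [Matrix.one_apply, Subtype.ext_iff]
    rw [hscalar, Matrix.det_smul, Matrix.det_one, mul_one]
    exact pow_ne_zero _ hΛ

end LinkingOfDet

end MixedGraph

namespace MixedGraph

section TangentDirections

variable {V : Type*} {G : MixedGraph V} {R : Type*}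

open Classical in
variable (G) in
/-- The matrix of the linear system `(S K)ₓᵧ + (S K)ᵧₓ = 0`, for the pairs `(x, y)` that are not
linked, in the unknown entries `K p v` at the edges `p → v`. For `S = Ω (I - Λ)⁻¹` its solutions are
the directions in which `Λ` can move, with a suitable motion of `Ω`, while `phi` stays constant. -/
noncomputable def tangentMatrix [AddMonoid R] (S : Matrix V V R) :
    Matrix {a : V × V // ¬ G.Linked a.1 a.2} (Σ v, G.pa v) R :=
  Matrix.of fun a e => (if e.1 = a.1.1 then S a.1.2 e.2 else 0) +
    (if e.1 = a.1.2 then S a.1.1 e.2 else 0)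

theorem tangentMatrix_apply [AddMonoid R] (S : Matrix V V R)
    {a : {a : V × V // ¬ G.Linked a.1 a.2}} {w v : V} (h : s(a.1.1, a.1.2) = s(w, v))
    (p : G.pa v) : G.tangentMatrix S a ⟨v, p⟩ = S w p := by
  obtain ⟨⟨x, y⟩, hxy⟩ := a
  have hne : x ≠ y := fun hxy' => hxy (Or.inl hxy')
  rcases Sym2.eq_iff.mp h with ⟨rfl, rfl⟩ | ⟨rfl, rfl⟩
  · simp [tangentMatrix, hne.symm]
  · simp [tangentMatrix, hne]

theorem tangentMatrix_congr_row [AddCommMonoid R] (S : Matrix V V R)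
    {a b : {a : V × V // ¬ G.Linked a.1 a.2}} (h : s(a.1.1, a.1.2) = s(b.1.1, b.1.2)) :
    G.tangentMatrix S a = G.tangentMatrix S b := by
  obtain ⟨⟨x, y⟩, hxy⟩ := a
  obtain ⟨⟨x', y'⟩, hxy'⟩ := b
  rcases Sym2.eq_iff.mp h with ⟨rfl, rfl⟩ | ⟨rfl, rfl⟩
  · rfl
  · exact funext fun e => add_comm _ _

theorem exists_eq_sym2_of_tangentMatrix_ne_zero [AddMonoid R] {S : Matrix V V R}
    {a : {a : V × V // ¬ G.Linked a.1 a.2}} {v : V} {p : G.pa v}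
    (h : G.tangentMatrix S a ⟨v, p⟩ ≠ 0) :
    ∃ w, ¬ G.Linked w v ∧ s(a.1.1, a.1.2) = s(w, v) := by
  obtain ⟨⟨x, y⟩, hxy⟩ := a
  rcases eq_or_ne v x with rfl | hx
  · exact ⟨y, fun hlinked => hxy hlinked.symm, Sym2.eq_swap⟩
  · rcases eq_or_ne v y with rfl | hy
    · exact ⟨x, hxy, rfl⟩
    · exact absurd (by simp [tangentMatrix, hx, hy]) h

open Classical in
/-- The matrix with given entries at the directed edges and zeros elsewhere. -/
noncomputable def edgeMatrix [Zero R] (k : (Σ v, G.pa v) → R) : Matrix V V R :=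
  Matrix.of fun p v => if h : G.D p v then k ⟨v, p, h⟩ else 0

theorem edgeMatrix_ne_zero [Zero R] {k : (Σ v, G.pa v) → R} (hk : k ≠ 0) :
    edgeMatrix k ≠ 0 := by
  obtain ⟨⟨v, p, h⟩, hkv⟩ := Function.ne_iff.mp hk
  intro hzero
  exact hkv (by simpa [edgeMatrix, show G.D p v from h] using congrFun (congrFun hzero p) v)

theorem tangentMatrix_mulVec [CommRing R] [Fintype V] [∀ v, Fintype (G.pa v)] (S : Matrix V V R)
    (k : (Σ v, G.pa v) → R) (a : {a : V × V // ¬ G.Linked a.1 a.2}) :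
    (G.tangentMatrix S *ᵥ k) a =
      (S * edgeMatrix k) a.1.1 a.1.2 + (S * edgeMatrix k) a.1.2 a.1.1 := by
  classical
  have hsum (x y : V) : ∑ e : Σ v, G.pa v, (if e.1 = y then S x e.2 else 0) * k e =
      (S * edgeMatrix k) x y := by
    simp only [Fintype.sum_sigma, ite_mul, zero_mul, Matrix.mul_apply]
    rw [Fintype.sum_eq_single y fun v hv => by simp [hv]]
    simp only [if_true]
    exact Fintype.sum_of_injective Subtype.val Subtype.val_injective _ _
      (fun p hp => by simp [edgeMatrix, show ¬ G.D p y from fun h => hp ⟨⟨p, h⟩, rfl⟩])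
      fun p => by simp [edgeMatrix, show G.D p y from p.2]
  simp only [Matrix.mulVec, dotProduct, tangentMatrix, Matrix.of_apply, add_mul,
    Finset.sum_add_distrib, hsum]
  rw [add_comm]

variable [CommRing R] [IsDomain R]

theorem exists_sources_det_ne_zero [CharZero R] [Fintype V] [DecidableEq V]
    [∀ v, Fintype (G.pa v)]
    {S : Matrix V V R} (hS : ∀ k, G.tangentMatrix S *ᵥ k = 0 → k = 0) :
    ∃ src : ∀ v, G.pa v → V, (∀ v p, ¬ G.Linked (src v p) v) ∧
      (∀ v, (S.submatrix (src v) Subtype.val : Matrix (G.pa v) (G.pa v) R).det ≠ 0) ∧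
      ∀ v w p q, src v p = w → src w q = v → v = w := by
  classical
  obtain ⟨r, hr⟩ := exists_det_submatrix_ne_zero hS
  obtain ⟨σ, hσ⟩ := exists_perm_forall_det_toSquareBlock_ne_zero Sigma.fst hr
  let row (v : V) (p : G.pa v) := r (σ ⟨v, p⟩)
  have hblock (v : V) : (Matrix.of fun p q : G.pa v =>
      G.tangentMatrix S (row v p) ⟨v, q⟩).det ≠ 0 := by
    have hv := hσ v
    rwa [← Matrix.det_submatrix_equiv_self (Equiv.sigmaSubtype v).symm] at hv
  have hrow (v : V) (p : G.pa v) : ∃ w, ¬ G.Linked w v ∧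
      s((row v p).1.1, (row v p).1.2) = s(w, v) := by
    obtain ⟨q, hq⟩ : ∃ q, G.tangentMatrix S (row v p) ⟨v, q⟩ ≠ 0 := by
      by_contra! hzero
      exact hblock v (Matrix.det_eq_zero_of_row_eq_zero p hzero)
    exact exists_eq_sym2_of_tangentMatrix_ne_zero hq
  choose src hsrc hrow using hrow
  refine ⟨src, hsrc, fun v => ?_, ?_⟩
  · convert hblock v using 2
    ext p q
    exact (tangentMatrix_apply S (hrow v p) q).symm
  · rintro v _ p q rfl hq
    by_contra hne
    refine hr (Matrix.det_zero_of_row_eq (i := σ ⟨v, p⟩) (j := σ ⟨src v p, q⟩)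
      (σ.injective.ne fun h => hne (congrArg Sigma.fst h)) (tangentMatrix_congr_row S ?_))
    exact (hrow v p).trans (Sym2.eq_swap.trans (hq ▸ hrow _ q).symm)

/-- If a direction `K` solves the linear system, then `phi` is constant to first order at `θ` along
this pair. The factor `det (I - Λ)` makes the entries polynomials in the entries of `θ` and `K`. -/
def fiberDirection [Fintype V] [DecidableEq V] (θ : MatrixPair V R) (K : Matrix V V R) :
    MatrixPair V R :=
  ((1 - θ.1).det • K,
    -(θ.2 * (1 - θ.1).adjugate * K + (θ.2 * (1 - θ.1).adjugate * K)ᵀ))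

variable [Fintype V] [DecidableEq V]

theorem HTCInfiniteToOne.exists_fiberDirection_mem_support [CharZero R] (h : G.HTCInfiniteToOne)
    {θ : MatrixPair V R} (hθ : θ ∈ G.support) (hdet : (1 - θ.1).det ≠ 0) :
    ∃ K ≠ 0, fiberDirection θ K ∈ G.support := by
  classical
  obtain ⟨k, hk, hk0⟩ : ∃ k, G.tangentMatrix (θ.2 * (1 - θ.1).adjugate) *ᵥ k = 0 ∧ k ≠ 0 := by
    by_contra! hker
    obtain ⟨src, hsrc, hminor, hpair⟩ := exists_sources_det_ne_zero hker
    rcases h fun v => Set.range (src v) with ⟨v, hv⟩ | ⟨v, w, hvw, ⟨p, hp⟩, ⟨q, hq⟩⟩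
    · have hinj : Function.Injective (src v) := fun p q hpq => by
        by_contra hne
        exact hminor v (Matrix.det_zero_of_row_eq hne
          (funext fun q => by simp only [Matrix.submatrix_apply, hpq]))
      refine hv (halfTrekCriterion_iff.mpr ⟨Set.forall_mem_range.mpr (hsrc v), ?_⟩)
      exact exists_halfTrekLinking_of_det_ne_zero hinj hθ (det_linkMatrix_ne_zero hdet (hminor v))
    · exact hvw (hpair v w q p hq hp)
  refine ⟨edgeMatrix k, edgeMatrix_ne_zero hk0, fun v w hvw => ?_, ?_, fun v w hvw => ?_⟩
  · simp [fiberDirection, edgeMatrix, hvw]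
  · simp [fiberDirection, Matrix.IsSymm, add_comm]
  · have hrow := congrFun hk ⟨(v, w), hvw⟩
    rw [tangentMatrix_mulVec] at hrow
    exact neg_eq_zero.mpr hrow

end TangentDirections

section PolynomialDirections

variable {V R S : Type*} {G : MixedGraph V}

/-- The image of a pair of matrices under a map of their entries. -/
def MatrixPair.map (f : R → S) (θ : MatrixPair V R) : MatrixPair V S :=
  (θ.1.map f, θ.2.map f)

theorem map_mem_support [Semiring R] [Semiring S] (f : R →+* S) {θ : MatrixPair V R}
    (hθ : θ ∈ G.support) : MatrixPair.map f θ ∈ G.support := by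
  obtain ⟨hD, hsymm, hB⟩ := hθ
  exact ⟨fun v w h => by simp [MatrixPair.map, hD v w h], hsymm.map f,
    fun v w h => by simp [MatrixPair.map, hB v w h]⟩

variable [DecidableEq V] [Fintype V]

omit [Fintype V] in
theorem map_one_sub [Ring R] [Ring S] (f : R →+* S) (A : Matrix V V R) :
    (1 - A).map f = 1 - A.map f := by
  rw [Matrix.map_sub _ (map_sub f), Matrix.map_one _ (map_zero f) (map_one f)]

theorem map_det_one_sub [CommRing R] [CommRing S] (f : R →+* S) (A : Matrix V V R) :
    f (1 - A).det = (1 - A.map f).det := by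
  rw [RingHom.map_det, RingHom.mapMatrix_apply, map_one_sub]

theorem map_fiberDirection [CommRing R] [CommRing S] (f : R →+* S) (θ : MatrixPair V R)
    (K : Matrix V V R) :
    MatrixPair.map f (fiberDirection θ K) = fiberDirection (MatrixPair.map f θ) (K.map f) := by
  have hadj : (1 - θ.1).adjugate.map f = (1 - θ.1.map f).adjugate := by
    rw [← RingHom.mapMatrix_apply, RingHom.map_adjugate, RingHom.mapMatrix_apply, map_one_sub]
  have hmul : (θ.2 * (1 - θ.1).adjugate * K).map f =
      θ.2.map f * (1 - θ.1.map f).adjugate * K.map f := by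
    rw [Matrix.map_mul, Matrix.map_mul, hadj]
  refine Prod.ext (Matrix.ext fun v w => ?_) (Matrix.ext fun v w => ?_)
  · simp [MatrixPair.map, fiberDirection, map_det_one_sub]
  · simp only [MatrixPair.map, fiberDirection, ← hmul, Matrix.map_apply, Matrix.neg_apply,
      Matrix.add_apply, Matrix.transpose_apply, map_neg, map_add]

omit [DecidableEq V] [Fintype V] in
theorem map_eval_genericPair (θ : MatrixPair V ℝ) :
    MatrixPair.map (MvPolynomial.eval (pairEntries θ)) (genericPair V) = θ :=
  Prod.ext (map_genericPair_fst θ) (map_genericPair_snd θ)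

omit [DecidableEq V] [Fintype V] in
theorem map_projectHom_genericPair_mem_support :
    MatrixPair.map G.projectHom (genericPair V) ∈ G.support := by
  refine ⟨fun v w h => by simp [MatrixPair.map, genericPair, projectHom, h], ?_,
    fun v w h => by simp [MatrixPair.map, genericPair, projectHom, h]⟩
  ext1 v w
  simp only [MatrixPair.map, genericPair, projectHom, Matrix.transpose_apply, Matrix.map_apply,
    Matrix.of_apply, MvPolynomial.aeval_X, Sum.elim_inr, Prod.swap_prod_mk]
  classical exact if_congr ⟨.symm, .symm⟩ (by rw [add_comm]) rfl

omit [DecidableEq V] [Fintype V] in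
theorem map_rangeRestrict_genericPair_mem_support :
    MatrixPair.map G.projectHom.rangeRestrict (genericPair V) ∈ G.support := by
  obtain ⟨hD, hsymm, hB⟩ := map_projectHom_genericPair_mem_support (G := G)
  exact ⟨fun v w h => Subtype.ext (hD v w h),
    Matrix.ext fun v w => Subtype.ext (congrFun (congrFun hsymm v) w),
    fun v w h => Subtype.ext (hB v w h)⟩

theorem HTCInfiniteToOne.exists_polynomial_fiberDirection_mem_support (h : G.HTCInfiniteToOne) :
    ∃ K : Matrix V V (MvPolynomial (Coord V) ℝ), (∃ v w, G.projectHom (K v w) ≠ 0) ∧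
      ∀ θ ∈ G.support,
        fiberDirection θ (K.map (MvPolynomial.eval (pairEntries θ))) ∈ G.support := by
  have : CharZero G.projectHom.range :=
    charZero_of_injective_algebraMap (algebraMap ℝ G.projectHom.range).injective
  let toRange : MvPolynomial (Coord V) ℝ →+* G.projectHom.range := G.projectHom.rangeRestrict
  have hdet : (1 - (MatrixPair.map toRange (genericPair V)).1).det ≠ 0 := by
    have hgeneric : G.projectHom (1 - (genericPair V).1).det ≠ 0 := by
      refine projectHom_ne_zero_of_mem_support zero_one_mem_support ?_
      rw [map_det_one_sub, map_genericPair_fst]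
      simp
    rw [MatrixPair.map, ← map_det_one_sub]
    exact fun h0 => hgeneric (congrArg Subtype.val h0)
  obtain ⟨K, hK0, hK⟩ :=
    h.exists_fiberDirection_mem_support map_rangeRestrict_genericPair_mem_support hdet
  choose κ hκ using fun v w => G.projectHom.rangeRestrict_surjective (K v w)
  refine ⟨Matrix.of κ, ?_, fun θ hθ => ?_⟩
  · by_contra! hzero
    exact hK0 (Matrix.ext fun v w => (hκ v w).symm.trans (Subtype.ext (hzero v w)))
  · let evalRange : G.projectHom.range →+* ℝ :=
      (MvPolynomial.eval (pairEntries θ)).comp G.projectHom.range.val.toRingHom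
    have heval : evalRange.comp toRange = MvPolynomial.eval (pairEntries θ) :=
      RingHom.ext fun p => (eval_projectHom _ p).trans (by rw [project_pairEntries hθ])
    have hgeneric : MatrixPair.map evalRange (MatrixPair.map toRange (genericPair V)) = θ := by
      conv_rhs => rw [← map_eval_genericPair θ, ← heval]
      rfl
    have hdir : K.map evalRange = (Matrix.of κ).map (MvPolynomial.eval (pairEntries θ)) := by
      ext v w
      rw [← heval, Matrix.map_apply, ← hκ]
      rfl
    rw [← hdir, ← hgeneric, ← map_fiberDirection]
    exact map_mem_support evalRange hK

end PolynomialDirections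

end MixedGraph

section Calculus

variable {F : Type*} [NormedAddCommGroup F] [NormedSpace ℝ F] {f : ℝ → F} {f' : F} {a : ℝ}

theorem eventually_eq_of_eventually_hasDerivAt_zero (h : ∀ᶠ t in 𝓝 a, HasDerivAt f 0 t) :
    ∀ᶠ t in 𝓝 a, f t = f a := by
  obtain ⟨ε, hε, hball⟩ := Metric.eventually_nhds_iff_ball.mp h
  filter_upwards [Metric.ball_mem_nhds a hε] with t ht
  exact Metric.isOpen_ball.is_const_of_deriv_eq_zero (convex_ball a ε).isPreconnected
    (fun s hs => (hball s hs).differentiableAt.differentiableWithinAt)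
    (fun s hs => (hball s hs).deriv) ht (Metric.mem_ball_self hε)

theorem infinite_of_hasDerivAt_ne_zero (hf : HasDerivAt f f' a) (hf' : f' ≠ 0) {S : Set F}
    (hS : ∀ᶠ t in 𝓝 a, f t ∈ S) : S.Infinite := by
  intro hfin
  have hpunctured : ∀ᶠ x in 𝓝[≠] f a, x ∉ S := by
    have hclosed : IsClosed (S \ {f a}) := (hfin.subset Set.sdiff_subset).isClosed
    filter_upwards [nhdsWithin_le_nhds (hclosed.isOpen_compl.mem_nhds fun h => h.2 rfl),
      self_mem_nhdsWithin] with x hx hne hxS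
    exact hx ⟨hxS, hne⟩
  obtain ⟨t, ht, htS⟩ := (((hf.tendsto_nhdsNE hf').eventually hpunctured).and
    (hS.filter_mono nhdsWithin_le_nhds)).exists
  exact ht htS

theorem hasDerivAt_matrix {m n : Type*} [Finite m] [Finite n] {A : ℝ → Matrix m n ℝ}
    {A' : Matrix m n ℝ} : HasDerivAt A A' a ↔ ∀ i j, HasDerivAt (fun t => A t i j) (A' i j) a := by
  have := Fintype.ofFinite m
  have := Fintype.ofFinite n
  exact hasDerivAt_pi.trans (forall_congr' fun _ => hasDerivAt_pi)

open scoped Matrix.Norms.Operator in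
theorem hasDerivAt_matrix_inv {n : Type*} [Fintype n] [DecidableEq n] {A : ℝ → Matrix n n ℝ}
    {A' : Matrix n n ℝ} (hA : HasDerivAt A A' a) (h : IsUnit (A a)) :
    HasDerivAt (fun t => (A t)⁻¹) (-((A a)⁻¹ * A' * (A a)⁻¹)) a := by
  obtain ⟨u, hu⟩ := h
  have hinv := hasFDerivAt_ringInverse (𝕜 := ℝ) u
  rw [hu] at hinv
  simpa [Function.comp_def, ← Matrix.nonsing_inv_eq_ringInverse, Matrix.coe_units_inv, hu] using!
    hinv.comp_hasDerivAt a hA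

end Calculus

namespace MixedGraph

section IntegralCurves

variable {V : Type*} [Finite V] {G : MixedGraph V}

open scoped Matrix.Norms.Operator in
theorem hasDerivAt_project {α : ℝ → Coord V → ℝ} {α' : Coord V → ℝ} {t : ℝ}
    (h : HasDerivAt α α' t) : HasDerivAt (fun s => G.project (α s)) (G.project α') t := by
  have := Fintype.ofFinite V
  have hcoord := hasDerivAt_pi.mp h
  refine HasDerivAt.prodMk (hasDerivAt_matrix.mpr fun v w => ?_)
    (hasDerivAt_matrix.mpr fun v w => ?_)
  · simp only [Matrix.of_apply]
    split_ifs
    exacts [hcoord _, hasDerivAt_const t 0]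
  · simp only [Matrix.of_apply]
    split_ifs
    exacts [((hcoord _).fun_add (hcoord _)).const_mul _, hasDerivAt_const t 0]

theorem exists_integralCurve_mem_support {X : MatrixPair V (MvPolynomial (Coord V) ℝ)}
    (hX : ∀ θ ∈ G.support, MatrixPair.map (MvPolynomial.eval (pairEntries θ)) X ∈ G.support)
    {θ₀ : MatrixPair V ℝ} (hθ₀ : θ₀ ∈ G.support) :
    ∃ θ : ℝ → MatrixPair V ℝ, θ 0 = θ₀ ∧ (∀ t, θ t ∈ G.support) ∧ ∀ᶠ t in 𝓝 0,
      HasDerivAt θ (MatrixPair.map (MvPolynomial.eval (pairEntries (θ t))) X) t := by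
  have := Fintype.ofFinite V
  let Y (a : Coord V → ℝ) := MatrixPair.map (MvPolynomial.eval (pairEntries (G.project a))) X
  have hY : ContDiff ℝ 1 fun a => pairEntries (Y a) := by
    have heval (p : MvPolynomial (Coord V) ℝ) :
        ContDiff ℝ 1 fun a => MvPolynomial.eval (pairEntries (G.project a)) p := by
      simp only [← eval_projectHom]
      exact (AnalyticOnNhd.eval_mvPolynomial _).contDiff
    refine contDiff_pi.mpr fun i => ?_
    rcases i with ⟨v, w⟩ | ⟨v, w⟩
    exacts [heval (X.1 v w), heval (X.2 v w)]
  obtain ⟨α, hα0, ε, hε, hα⟩ :=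
    hY.contDiffAt.exists_forall_mem_closedBall_exists_eq_forall_mem_Ioo_hasDerivAt₀
      (x₀ := pairEntries θ₀) 0
  refine ⟨fun t => G.project (α t), (congrArg _ hα0).trans (project_pairEntries hθ₀),
    fun t => project_mem_support _, ?_⟩
  filter_upwards [Ioo_mem_nhds (by linarith : 0 - ε < 0) (by linarith : 0 < 0 + ε)] with t ht
  have hproject := hasDerivAt_project (G := G) (hα t ht)
  rwa [project_pairEntries (hX _ (project_mem_support (α t)))] at hproject

end IntegralCurves

section InfiniteFibers

variable {V : Type*} [Fintype V] [DecidableEq V] {G : MixedGraph V}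

open scoped Matrix.Norms.Operator in
theorem hasDerivAt_phi {θ : ℝ → MatrixPair V ℝ} {θ' : MatrixPair V ℝ} {t : ℝ}
    (hθ : HasDerivAt θ θ' t) (h : IsUnit (1 - (θ t).1)) :
    HasDerivAt (fun s => phi (θ s))
      (((1 - (θ t).1)⁻¹)ᵀ * (((1 - (θ t).1)⁻¹ * θ'.1)ᵀ * (θ t).2 + θ'.2 +
        (θ t).2 * ((1 - (θ t).1)⁻¹ * θ'.1)) * (1 - (θ t).1)⁻¹) t := by
  have hΛ : HasDerivAt (fun s => (θ s).1) θ'.1 t :=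
    (hasFDerivAt_fst (p := θ t)).comp_hasDerivAt t hθ
  have hΩ : HasDerivAt (fun s => (θ s).2) θ'.2 t :=
    (hasFDerivAt_snd (p := θ t)).comp_hasDerivAt t hθ
  have hinv : HasDerivAt (fun s => (1 - (θ s).1)⁻¹)
      ((1 - (θ t).1)⁻¹ * θ'.1 * (1 - (θ t).1)⁻¹) t := by
    simpa using hasDerivAt_matrix_inv (hΛ.const_sub 1) h
  have hinvT : HasDerivAt (fun s => ((1 - (θ s).1)⁻¹)ᵀ)
      ((1 - (θ t).1)⁻¹ * θ'.1 * (1 - (θ t).1)⁻¹)ᵀ t :=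
    hasDerivAt_matrix.mpr fun v w => hasDerivAt_matrix.mp hinv w v
  refine ((hinvT.fun_mul hΩ).fun_mul hinv).congr_deriv ?_
  rw [Matrix.transpose_mul _ (1 - (θ t).1)⁻¹]
  noncomm_ring

theorem hasDerivAt_phi_of_fiberDirection {θ : ℝ → MatrixPair V ℝ} {K : Matrix V V ℝ} {t : ℝ}
    (hθ : HasDerivAt θ (fiberDirection (θ t) K) t) (hsymm : (θ t).2.IsSymm)
    (h : IsUnit (1 - (θ t).1)) : HasDerivAt (fun s => phi (θ s)) 0 t := by
  have hadj : (1 - (θ t).1)⁻¹ * (fiberDirection (θ t) K).1 = (1 - (θ t).1).adjugate * K := by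
    rw [fiberDirection, Matrix.mul_smul, ← Matrix.smul_mul, Matrix.inv_def, smul_smul,
      Ring.mul_inverse_cancel _ ((Matrix.isUnit_iff_isUnit_det _).mp h), one_smul]
  have hsum : ((1 - (θ t).1).adjugate * K)ᵀ * (θ t).2 + (fiberDirection (θ t) K).2 +
      (θ t).2 * ((1 - (θ t).1).adjugate * K) = 0 := by
    have htranspose : ((θ t).2 * ((1 - (θ t).1).adjugate * K))ᵀ =
        ((1 - (θ t).1).adjugate * K)ᵀ * (θ t).2 := by
      rw [Matrix.transpose_mul, hsymm.eq]
    rw [fiberDirection, mul_assoc, htranspose, neg_add_rev, add_neg_cancel_left, neg_add_cancel]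
  simpa only [hadj, hsum, mul_zero, zero_mul] using hasDerivAt_phi hθ h

theorem mem_fiber_of_phi_eq {θ θ₀ : MatrixPair V ℝ} (hθ₀ : θ₀ ∈ G.Theta) (hθ : θ ∈ G.support)
    (h : IsUnit (1 - θ.1)) (hphi : phi θ = phi θ₀) : θ ∈ G.fiber θ₀ := by
  have hpos : (phi θ₀).PosDef := by
    simpa [phi] using hθ₀.2.1.conjTranspose_mul_mul_same (B := (1 - θ₀.1)⁻¹)
      (Matrix.mulVec_injective_iff_isUnit.mpr (Matrix.isUnit_nonsing_inv_iff.mpr hθ₀.1.2))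
  have hΩ : θ.2.PosDef := by
    rw [← one_sub_transpose_mul_phi_mul h, hphi]
    simpa using hpos.conjTranspose_mul_mul_same (B := 1 - θ.1)
      (Matrix.mulVec_injective_iff_isUnit.mpr h)
  exact ⟨⟨⟨hθ.1, h⟩, hΩ, fun v w hne hB => hθ.2.2 v w (not_or.mpr ⟨hne, hB⟩)⟩, hphi⟩

open scoped Matrix.Norms.Operator in
theorem fiber_infinite {K : Matrix V V (MvPolynomial (Coord V) ℝ)}
    (hK : ∀ θ ∈ G.support,
      fiberDirection θ (K.map (MvPolynomial.eval (pairEntries θ))) ∈ G.support)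
    {θ₀ : MatrixPair V ℝ} (hθ₀ : θ₀ ∈ G.Theta)
    (hne : K.map (MvPolynomial.eval (pairEntries θ₀)) ≠ 0) : (G.fiber θ₀).Infinite := by
  have hmap (θ : MatrixPair V ℝ) :
      MatrixPair.map (MvPolynomial.eval (pairEntries θ)) (fiberDirection (genericPair V) K) =
        fiberDirection θ (K.map (MvPolynomial.eval (pairEntries θ))) := by
    rw [map_fiberDirection, map_eval_genericPair]
  obtain ⟨θ, rfl, hsupport, hderiv⟩ := exists_integralCurve_mem_support
    (fun θ hθ => (hmap θ).symm ▸ hK θ hθ) (Theta_subset_support hθ₀)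
  simp only [hmap] at hderiv
  have hcont : ContinuousAt (fun t => (1 - (θ t).1).det) 0 := by
    have := hderiv.self_of_nhds.continuousAt
    fun_prop
  have hdet : (1 - (θ 0).1).det ≠ 0 := ((Matrix.isUnit_iff_isUnit_det _).mp hθ₀.1.2).ne_zero
  have hunit : ∀ᶠ t in 𝓝 0, IsUnit (1 - (θ t).1) :=
    (hcont.eventually_ne hdet).mono fun t ht =>
      (Matrix.isUnit_iff_isUnit_det _).mpr ht.isUnit
  have hphi : ∀ᶠ t in 𝓝 0, phi (θ t) = phi (θ 0) := by
    refine eventually_eq_of_eventually_hasDerivAt_zero (f := fun t => phi (θ t)) ?_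
    filter_upwards [hderiv, hunit] with t ht htunit
    exact hasDerivAt_phi_of_fiberDirection ht (hsupport t).2.1 htunit
  refine infinite_of_hasDerivAt_ne_zero hderiv.self_of_nhds
    (fun h => smul_ne_zero hdet hne (congrArg Prod.fst h)) ?_
  filter_upwards [hunit, hphi] with t htunit htphi
  exact mem_fiber_of_phi_eq hθ₀ (hsupport t) htunit htphi

theorem HTCInfiniteToOne.genericallyInfiniteToOne (h : G.HTCInfiniteToOne) :
    G.GenericallyInfiniteToOne := by
  obtain ⟨K, ⟨v, w, hvw⟩, hK⟩ := h.exists_polynomial_fiberDirection_mem_support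
  refine exists_isProperAlgebraicSubset ?_
  filter_upwards [eventually_mem_Theta, eventually_eval_ne_zero hvw] with θ hθ hne
  exact fiber_infinite hK hθ fun h => hne (congrFun (congrFun h v) w)

end InfiniteFibers

end MixedGraph

theorem theorem3 {V : Type*} [Fintype V] [DecidableEq V] (G : MixedGraph V) :
    (G.WeakHTCIdentifiable → G.RationallyIdentifiable) ∧
    (G.WeakHTCInfiniteToOne → G.GenericallyInfiniteToOne) ∧
    (G.WeakHTCIdentifiable ↔ G.HTCIdentifiable) ∧
    (G.WeakHTCInfiniteToOne ↔ G.HTCInfiniteToOne) :=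
  ⟨fun h => (MixedGraph.weakHTCIdentifiable_iff.mp h).rationallyIdentifiable,
    fun h => (MixedGraph.weakHTCInfiniteToOne_iff.mp h).genericallyInfiniteToOne,
    MixedGraph.weakHTCIdentifiable_iff, MixedGraph.weakHTCInfiniteToOne_iff⟩
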